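/- A market consists of finite sets $B$ of buyers, $S$ of stores and $D$ of couriers, valuations $v_b(s)\ge 0$ and delivery costs $c_d(b,s)\ge 0$ ($b\in B$, $s\in S$, $d\in D$). An order is a pair $(b,s)\in B\times S$. An allocation is a table $\mathbf x=(x_{bsd})$ with entries in $\{0,1\}$, where $x_{bsd}=1$ means that $b$ buys from $s$ and $d$ delivers; it is feasible if $\sum_{s,d}x_{bsd}\le 1$ for every $b$, $\sum_{b,d}x_{bsd}\le 1$ for every $s$, and $\sum_{b,s}x_{bsd}\le 1$ for every $d$. For feasible $\mathbf x$ let $s_{\mathbf x}(b)\in S\cup\{\emptyset\}$ be the store that $b$ buys from and $o_{\mathbf x}(d)\in (B\times S)\cup\{\emptyset\}$ the order that $d$ delivers, with $\emptyset$ if there is none. For an agent with utility function $u$ on a set $A$ of options, the set of best responses is $\{a\in A: u(a)\ge u(a')\ \forall a'\in A\}$ if $u(a)>0$ for some $a\in A$, and $\{\emptyset\}\cup\{a\in A: u(a)=0\}$ otherwise. Given real delivery compensations $w_{bs}\ge 0$ and tips $t_{bs}\ge 0$, $\mathrm{BR}_d(\mathbf w,\mathbf t)$ is the set of best responses of courier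 $d$ for the utility $u_d(b,s)=w_{bs}-c_d(b,s)+t_{bs}$ on orders. The minimum tip $\underline t_{bs}=\underline t_{bs}(\mathbf w,\mathbf t_{-b})\in[0,\infty]$ is the least $\tau$ such that buyer $b$ has a nonnegative vector $\mathbf r_b$ of tips with $r_{bs}=\tau$ and some courier $d$ satisfies $(b,s)\in\mathrm{BR}_d(\mathbf w,\mathbf r_b,\mathbf t_{-b})$ ($\underline t_{bs}=\infty$ if there is no courier). Given real prices $p_s\ge 0$, $\mathrm{BR}_b(\mathbf p,\mathbf w,\mathbf t_{-b})$ is the set of best responses of buyer $b$ for the utility $v_b(s)-p_s-\underline t_{bs}$ on stores. A with-tip equilibrium is a quadruple $(\mathbf p,\mathbf w,\mathbf t,\mathbf x)$ of nonnegative real prices, compensations and tips and a feasible allocation such that 1. $s_{\mathbf x}(b)\in \mathrm{BR}_b(\mathbf p,\mathbf w,\mathbf t_{-b})$ for every buyer $b$, and $t_{bs}=\underline t_{bs}$ whenever $s=s_{\mathbf x}(b)\ne\emptyset$; 2. $o_{\mathbf x}(d)\in\mathrm{BR}_d(\mathbf w,\mathbf t)$ for every courier $d$; 3. $p_s=0$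 for every store $s$ with $\sum_{b,d}x_{bsd}=0$; 4. $w_{bs}=t_{bs}=0$ for every order $(b,s)$ with $\sum_d x_{bsd}=0$. **Theorem.** The following decision problem can be solved in polynomial time, that is, by a (multi-stack) Turing machine whose number of steps is bounded by a polynomial in the length of the input. Input: a market with rational valuations and costs, and an allocation $\mathbf x$, encoded by one symbol for each buyer, store and courier, the tables of valuations and costs with numerators and denominators in binary (fractions in lowest terms), and the table of $\mathbf x$. Question: are there $\mathbf p,\mathbf w,\mathbf t$ such that $(\mathbf p,\mathbf w,\mathbf t,\mathbf x)$ is a with-tip equilibrium of the market? -/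

import Mathlib

open Computability

namespace DeliveryMarket

/-! ### The three-sided market -/

/-- A market with buyers `B`, stores `S` and couriers `D`: valuations `v_b(s) ≥ 0` and delivery
costs `c_d(b, s) ≥ 0`.  Store costs are normalized to zero. -/
structure Market (B S D : Type*) where
  value : B → S → ℝ
  cost : D → B → S → ℝ
  value_nonneg : ∀ b s, 0 ≤ value b s
  cost_nonneg : ∀ d b s, 0 ≤ cost d b s

/-- An allocation is a 0/1 table: `x b s d = true` when `b` buys from `s` and `d` delivers. -/
abbrev Allocation (B S D : Type*) := B → S → D → Bool

section Definitions

variable {B S D : Type*}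

/-- Unit demand, unit supply and unit capacity. -/
def Allocation.IsFeasible [Fintype B] [Fintype S] [Fintype D] (x : Allocation B S D) : Prop :=
  (∀ b, ∑ s, ∑ d, (x b s d).toNat ≤ 1) ∧
  (∀ s, ∑ b, ∑ d, (x b s d).toNat ≤ 1) ∧
  (∀ d, ∑ b, ∑ s, (x b s d).toNat ≤ 1)

/-- `x.StoreIs b o`: the (possibly null) store that buyer `b` buys from in `x` is `o`. -/
def Allocation.StoreIs (x : Allocation B S D) (b : B) : Option S → Prop
  | none => ∀ s d, x b s d = false
  | some s => ∃ d, x b s d = true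

/-- `x.OrderIs d o`: the (possibly null) order that courier `d` delivers in `x` is `o`. -/
def Allocation.OrderIs (x : Allocation B S D) (d : D) : Option (B × S) → Prop
  | none => ∀ b s, x b s d = false
  | some q => x q.1 q.2 d = true

/-- The choices that are best responses for an agent with utility `u` on the non-null options and
utility zero on the null option `none`: if some option has positive utility, all the maximizers;
otherwise the null option and the options with utility zero. -/
def bestResponses {α R : Type*} [Preorder R] [Zero R] (u : α → R) : Set (Option α) :=
  {o | ((∃ a, 0 < u a) ∧ ∃ a, o = some a ∧ ∀ a', u a' ≤ u a) ∨
       ((¬ ∃ a, 0 < u a) ∧ (o = none ∨ ∃ a, o = some a ∧ u a = 0))}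

namespace Market

variable (M : Market B S D)

/-- Utility of courier `d` from delivering the order `q`, under compensations `w`, tips `t`. -/
def courierUtility (w t : B → S → ℝ) (d : D) (q : B × S) : ℝ :=
  w q.1 q.2 - M.cost d q.1 q.2 + t q.1 q.2

/-- `BR_d(w, t)`. -/
def courierBR (w t : B → S → ℝ) (d : D) : Set (Option (B × S)) :=
  bestResponses (M.courierUtility w t d)

/-- The tips `τ` on the order `(b, s)` for which buyer `b` has a nonnegative vector `r` of tips,
offering `τ` on the store `s`, such that the order `(b, s)` is a best response of some courier when
the other buyers' tips stay as in `t`.  Row `b` of `t` is overwritten, so it is irrelevant. -/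
def sufficientTips [DecidableEq B] (w t : B → S → ℝ) (b : B) (s : S) : Set ℝ :=
  {τ | ∃ r : S → ℝ, (∀ s', 0 ≤ r s') ∧ r s = τ ∧
    ∃ d, some (b, s) ∈ M.courierBR w (Function.update t b r) d}

/-- The minimum tip that makes some courier deliver from `s` to `b`.  On a finite market with a
courier it is attained; if there is no courier, no tip suffices and it is `⊤`. -/
noncomputable def minTip [DecidableEq B] (w t : B → S → ℝ) (b : B) (s : S) : EReal :=
  sInf ((fun τ : ℝ => (τ : EReal)) '' M.sufficientTips w t b s)

/-- The utility `v_b(s) - p_s - minTip` that buyer `b` expects from buying from store `s`. -/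
noncomputable def buyerUtility [DecidableEq B] (p : S → ℝ) (w t : B → S → ℝ) (b : B) (s : S) :
    EReal :=
  (M.value b s : EReal) - (p s : EReal) - M.minTip w t b s

/-- `BR_b(p, w, t_{-b})`. -/
noncomputable def buyerBR [DecidableEq B] (p : S → ℝ) (w t : B → S → ℝ) (b : B) :
    Set (Option S) :=
  bestResponses (M.buyerUtility p w t b)

/-- `(p, w, t, x)` is a with-tip equilibrium: purchase prices `p`, delivery compensations `w`,
tips `t` and a feasible allocation `x`. -/
structure IsWithTipEquilibrium [Fintype B] [Fintype S] [Fintype D] [DecidableEq B]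
    (p : S → ℝ) (w t : B → S → ℝ) (x : Allocation B S D) : Prop where
  price_nonneg : ∀ s, 0 ≤ p s
  compensation_nonneg : ∀ b s, 0 ≤ w b s
  tip_nonneg : ∀ b s, 0 ≤ t b s
  feasible : x.IsFeasible
  buyer_favorite : ∀ b o, x.StoreIs b o → o ∈ M.buyerBR p w t b
  pays_minTip : ∀ b s, x.StoreIs b (some s) → (t b s : EReal) = M.minTip w t b s
  courier_favorite : ∀ d o, x.OrderIs d o → o ∈ M.courierBR w t d
  unsold_price : ∀ s, (∀ b d, x b s d = false) → p s = 0
  undelivered : ∀ b s, (∀ d, x b s d = false) → w b s = 0 ∧ t b s = 0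

/-- Some with-tip equilibrium includes the allocation `x`. -/
def SupportsAllocation [Fintype B] [Fintype S] [Fintype D] [DecidableEq B]
    (x : Allocation B S D) : Prop :=
  ∃ (p : S → ℝ) (w t : B → S → ℝ), M.IsWithTipEquilibrium p w t x

end Market

end Definitions

/-! ### Problem instances and their encoding -/

/-- An input of the decision problem: a market with `m` buyers, `n` stores and `l` couriers, whose
valuations and costs are nonnegative rational numbers, and an allocation. -/
structure Input where
  m : ℕ
  n : ℕ
  l : ℕ
  value : Fin m → Fin n → ℚ≥0
  cost : Fin l → Fin m → Fin n → ℚ≥0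
  alloc : Allocation (Fin m) (Fin n) (Fin l)

/-- The market described by an input. -/
def Input.market (I : Input) : Market (Fin I.m) (Fin I.n) (Fin I.l) where
  value b s := (I.value b s : ℝ)
  cost d b s := (I.cost d b s : ℝ)
  value_nonneg _ _ := NNRat.cast_nonneg _
  cost_nonneg _ _ _ := NNRat.cast_nonneg _

/-- A natural number in unary, followed by a comma. -/
def encodeSize (k : ℕ) : List Γ' := List.replicate k (Γ'.bit true) ++ [Γ'.comma]

/-- A nonnegative rational number: numerator and denominator in lowest terms, both in binary and
followed by a comma. -/
def encodeRat (q : ℚ≥0) : List Γ' :=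
  encodingNatΓ'.encode q.num ++ [Γ'.comma] ++ encodingNatΓ'.encode q.den ++ [Γ'.comma]

/-- An input as a word over the finite alphabet `Γ'`: one symbol for each buyer, store and courier,
then the table of valuations, the table of costs and the table of the allocation. -/
def Input.encode (I : Input) : List Γ' :=
  encodeSize I.m ++ encodeSize I.n ++ encodeSize I.l ++
  ((List.finRange I.m).flatMap fun b => (List.finRange I.n).flatMap fun s =>
    encodeRat (I.value b s)) ++
  ((List.finRange I.m).flatMap fun b => (List.finRange I.n).flatMap fun s =>
    (List.finRange I.l).flatMap fun d => encodeRat (I.cost d b s)) ++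
  ((List.finRange I.m).flatMap fun b => (List.finRange I.n).flatMap fun s =>
    (List.finRange I.l).map fun d => Γ'.bit (I.alloc b s d))

/-! ### Polynomial time -/

/-- The property `P` of inputs encoded by `enc` can be decided in polynomial time: a (multi-stack)
Turing machine computes its truth value in a number of steps that is bounded by a polynomial in the
length of the encoded input. -/
def DecidableInPolyTime {α Γ : Type} [Fintype Γ] (enc : α → List Γ) (P : α → Prop) : Prop :=
  ∃ f : α → Bool, (∀ a, f a = true ↔ P a) ∧
    Nonempty (Turing.TM2ComputableInPolyTime enc encodeBool f)

end DeliveryMarket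

/-! Economics. Tips can be dispensed with. In an equilibrium let `k d ≥ 0` be the utility that
courier `d` obtains. Buyer `b` can make `d` deliver from `s` by tipping `max 0 (c_d(b,s) - w_bs + k
d)` there and nothing elsewhere, so the minimum tip lies between `0` and `c_d(b,s) + k d`. Hence `k`
and the prices satisfy the linear inequalities `IsSolution`: no courier gains by taking over another
courier's order, and no buyer prefers another store even if the full `c + k` of some courier is
added to its price. Conversely, a solution gives an equilibrium with zero tips, in which a delivered
order is compensated by `k d + c_d(b,s)`: the minimum tip is then zero on delivered orders and at
least the smallest `c + k` on all others. This equivalence is `Market.supportsAllocation_iff`.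

Algorithm. Every inequality reads `y i + a ≤ y j + y k + b`. The right-hand side is monotone, so
starting from an upper bound one may lower the left-hand variables without ever cutting off a
solution. With two variables on the right it is not obvious that this stops early, but as many
rounds as there are variables suffice (`holds_iterate_relaxFun`): if a round brought no further
variable to its limit, the limit could be raised by one on all variables that are still too large
and would remain a solution, contradicting that it is the limit. An upper bound to start from comes
from `IsSolution.exists_le`. Multiplying by the product of all denominators makes the data integral
and keeps their binary length polynomial; relaxing integral data stays integral, so real solvability
is decided exactly.

Complexity. Structured stack programs are compiled to multi-stack machines step for step
(`Run.leads`). Values are trees written in preorder, a self-delimiting format, so programs can copy,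
swap and drop them. The class `PolyTime` is closed under composition, pairing, case distinction and
folds whose intermediate values stay polynomially bounded; binary arithmetic and list operations
follow, and the whole decision procedure is assembled from them. -/

/-! ### Structured stack programs -/

namespace StackProgram

open Turing Function

/-- The stacks of a structured program: the input, the stack of values, and three auxiliary
stacks. -/
inductive Stack
  | inp | main | aux | tmp | cnt
  deriving DecidableEq

instance : Fintype Stack :=
  ⟨{.inp, .main, .aux, .tmp, .cnt}, fun k => by cases k <;> decide⟩

/-- Structured programs over stacks of symbols of `Γ'`. -/
inductive Prog
  | skip
  | push (k : Stack) (a : Γ')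
  | seq (p q : Prog)
  | pop (k : Stack) (f : Option Γ' → Prog)
  | loop (k : Stack) (cond : Option Γ' → Bool) (body : Option Γ' → Prog)

/-- The contents of all stacks. -/
abbrev Store := Stack → List Γ'

/-- `Run p S S' t`: from the store `S`, the program `p` ends in the store `S'` after `t` steps. -/
inductive Run : Prog → Store → Store → ℕ → Prop
  | skip S : Run .skip S S 1
  | push k a S : Run (.push k a) S (update S k (a :: S k)) 1
  | seq {p q S S' S'' t t'} : Run p S S' t → Run q S' S'' t' → Run (.seq p q) S S'' (t + t')
  | pop {k f S S' t} : Run (f (S k).head?) (update S k (S k).tail) S' t →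
      Run (.pop k f) S S' (t + 1)
  | exit {k cond body S} : cond (S k).head? = false →
      Run (.loop k cond body) S (update S k (S k).tail) 1
  | loop {k cond body S S' S'' t t'} : cond (S k).head? = true →
      Run (body (S k).head?) (update S k (S k).tail) S' t →
      Run (.loop k cond body) S' S'' t' → Run (.loop k cond body) S S'' (t + 1 + t')

namespace Prog

/-- The labels of the compiled program. -/
def Lab : Prog → Type
  | skip => Unit
  | push _ _ => Unit
  | seq p q => p.Lab ⊕ q.Lab
  | pop _ f => Option (Σ o, (f o).Lab)
  | loop _ _ body => Option (Σ o, (body o).Lab)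

/-- There are finitely many labels. -/
@[reducible]
def labFintype : (p : Prog) → Fintype p.Lab
  | skip => inferInstanceAs (Fintype Unit)
  | push _ _ => inferInstanceAs (Fintype Unit)
  | seq p q =>
    have := p.labFintype
    have := q.labFintype
    inferInstanceAs (Fintype (p.Lab ⊕ q.Lab))
  | pop _ f =>
    have := fun o => (f o).labFintype
    inferInstanceAs (Fintype (Option (Σ o, (f o).Lab)))
  | loop _ _ body =>
    have := fun o => (body o).labFintype
    inferInstanceAs (Fintype (Option (Σ o, (body o).Lab)))

/-- The label at which the compiled program starts. -/
def entry : (p : Prog) → p.Lab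
  | skip => ()
  | push _ _ => ()
  | seq p _ => .inl p.entry
  | pop _ _ => none
  | loop _ _ _ => none

/-- The alphabets of the compiled machine, which has one more stack for its output. -/
abbrev Alphabet : Option Stack → Type
  | none => Bool
  | some _ => Γ'

/-- Compilation into a larger machine: `ι` embeds the labels, `e` is the label to exit to. -/
def code {Λ : Type} : (p : Prog) → (p.Lab → Λ) → Λ → p.Lab → TM2.Stmt Alphabet Λ (Option Γ')
  | skip, _, e, _ => .goto fun _ => e
  | push k a, _, e, _ => .push (some k) (fun _ => (a : Γ')) (.goto fun _ => e)
  | seq p q, ι, _, .inl l => p.code (ι ∘ Sum.inl) (ι (.inr q.entry)) l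
  | seq _ q, ι, e, .inr l => q.code (ι ∘ Sum.inr) e l
  | pop k f, ι, _, none =>
    .pop (some k) (fun _ o => (o : Option Γ')) (.goto fun v => ι (some ⟨v, (f v).entry⟩))
  | pop _ f, ι, e, some ⟨o, l⟩ => (f o).code (fun l => ι (some ⟨o, l⟩)) e l
  | loop k cond body, ι, e, none =>
    .pop (some k) (fun _ o => (o : Option Γ'))
      (.goto fun v => if cond v then ι (some ⟨v, (body v).entry⟩) else e)
  | loop _ _ body, ι, _, some ⟨o, l⟩ => (body o).code (fun l => ι (some ⟨o, l⟩)) (ι none) l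

end Prog

/-- The stacks of the machine when the output stack is empty. -/
def Store.toStk (S : Store) : (k : Option Stack) → List (Prog.Alphabet k)
  | none => []
  | some k => S k

theorem Store.toStk_update (S : Store) (k : Stack) (l : List Γ') :
    Store.toStk (update S k l) = update (Store.toStk S) (some k) l := by
  funext o
  cases o with
  | none => rfl
  | some k' =>
    by_cases h : k' = k
    · subst h
      exact (update_self k' l S).trans (update_self (some k') l S.toStk).symm
    · exact (update_of_ne h l S).trans
        (update_of_ne (fun h' => h (Option.some.inj h')) l S.toStk).symm

/-- `c` leads to `c'` in `t` steps of the machine with statements `M`. -/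
def Leads {Λ : Type} (M : Λ → TM2.Stmt Prog.Alphabet Λ (Option Γ')) (t : ℕ)
    (c c' : TM2.Cfg Prog.Alphabet Λ (Option Γ')) : Prop :=
  (flip bind (TM2.step M))^[t] (some c) = some c'

theorem Leads.trans {Λ : Type} {M : Λ → TM2.Stmt Prog.Alphabet Λ (Option Γ')} {t t' : ℕ}
    {c c' c''} (h : Leads M t c c') (h' : Leads M t' c' c'') : Leads M (t + t') c c'' := by
  unfold Leads at *
  rw [Nat.add_comm, iterate_add_apply, h, h']

theorem Leads.single {Λ : Type} {M : Λ → TM2.Stmt Prog.Alphabet Λ (Option Γ')} {c c'}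
    (h : TM2.step M c = some c') : Leads M 1 c c' := h

/-- Compilation is correct and preserves the number of steps. -/
theorem Run.leads {p : Prog} {S S' : Store} {t : ℕ} (h : Run p S S' t) {Λ : Type}
    (M : Λ → TM2.Stmt Prog.Alphabet Λ (Option Γ')) (ι : p.Lab → Λ) (e : Λ)
    (hM : ∀ l, M (ι l) = p.code ι e l) (v : Option Γ') :
    ∃ v', Leads M t ⟨some (ι p.entry), v, S.toStk⟩ ⟨some e, v', S'.toStk⟩ := by
  induction h generalizing e v with
  | skip S =>
    refine ⟨v, Leads.single ?_⟩
    change some (TM2.stepAux (M (ι _)) _ _) = _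
    rw [hM]
    rfl
  | push k a S =>
    refine ⟨v, Leads.single ?_⟩
    change some (TM2.stepAux (M (ι _)) _ _) = _
    rw [hM, Store.toStk_update]
    rfl
  | @seq p q S S' S'' t t' _ _ ih₁ ih₂ =>
    obtain ⟨v₁, h₁⟩ := ih₁ (ι ∘ Sum.inl) (ι (.inr q.entry)) (fun l => hM (.inl l)) v
    obtain ⟨v₂, h₂⟩ := ih₂ (ι ∘ Sum.inr) e (fun l => hM (.inr l)) v₁
    exact ⟨v₂, h₁.trans h₂⟩
  | @pop k f S S' t _ ih =>
    obtain ⟨v₁, h₁⟩ := ih (fun l => ι (some ⟨_, l⟩)) e (fun l => hM (some ⟨_, l⟩)) (S k).head?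
    refine ⟨v₁, Nat.add_comm 1 t ▸ Leads.trans (Leads.single ?_) h₁⟩
    change some (TM2.stepAux (M (ι none)) _ _) = _
    rw [hM none, Store.toStk_update]
    rfl
  | @exit k cond body S hc =>
    refine ⟨(S k).head?, Leads.single ?_⟩
    change some (TM2.stepAux (M (ι none)) _ _) = _
    -- The machine chooses its next label by the popped symbol; when the test fails, the choice is
    -- `e`.
    have : e = if cond (S k).head? then ι (some ⟨(S k).head?, (body (S k).head?).entry⟩) else e := by
      simp [hc]
    rw [hM none, Store.toStk_update]
    conv_rhs => rw [this]
    rfl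
  | @loop k cond body S S' S'' t t' hc _ _ ih₁ ih₂ =>
    obtain ⟨v₁, h₁⟩ := ih₁ (fun l => ι (some ⟨_, l⟩)) (ι none) (fun l => hM (some ⟨_, l⟩))
      (S k).head?
    obtain ⟨v₂, h₂⟩ := ih₂ ι e hM v₁
    refine ⟨v₂, Leads.trans (Nat.add_comm 1 t ▸ Leads.trans (Leads.single ?_) h₁) h₂⟩
    change some (TM2.stepAux (M (ι none)) _ _) = _
    have : ι (some ⟨(S k).head?, (body (S k).head?).entry⟩) =
        if cond (S k).head? then ι (some ⟨(S k).head?, (body (S k).head?).entry⟩) else e := by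
      simp [hc]
    rw [hM none, Store.toStk_update]
    conv_rhs => rw [this]
    rfl

/-- The store with only the input and the stack of values nonempty. -/
def values (i m : List Γ') : Store
  | .inp => i
  | .main => m
  | _ => []

/-- The machine that runs a program and answers whether the program leaves `bit b` on the stack of
values. -/
def machine (p : Prog) : FinTM2 :=
  letI := p.labFintype
  { K := Option Stack
    k₀ := some .inp
    k₁ := none
    Γ := Prog.Alphabet
    Λ := Option p.Lab
    main := some p.entry
    σ := Option Γ'
    initialState := none
    Γk₀Fin := inferInstanceAs (Fintype Γ')
    m := fun l => match l with
      | some l => p.code some none l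
      | none => .pop (some .main) (fun _ o => (o : Option Γ'))
          (.push none (fun v => (decide (v = some (Γ'.bit true)) : Bool))
            (.load (fun _ => none) .halt)) }

theorem initList_machine (p : Prog) (w : List Γ') :
    initList (machine p) w = ⟨some (some p.entry), none, (values w []).toStk⟩ := by
  change TM2.Cfg.mk _ _ _ = TM2.Cfg.mk _ _ _
  congr 1
  funext k
  rcases k with - | k
  · rfl
  · cases k <;> rfl

/-- The halting configuration prescribes the register and all stacks, so the last label moves the
answer to the output stack and resets the arbitrary register value `v`. -/
theorem step_machine_none (p : Prog) (v : Option Γ') (b : Bool) :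
    TM2.step (machine p).m ⟨some none, v, (values [] [Γ'.bit b]).toStk⟩ =
      some (haltList (machine p) [b]) := by
  change some (TM2.Cfg.mk _ _ _) = some (TM2.Cfg.mk _ _ _)
  congr 2
  funext k
  rcases k with - | k
  · cases b <;> rfl
  · cases k <;> rfl

/-- A property is decidable in polynomial time if a program decides it in polynomial time. -/
theorem decidableInPolyTime_of_run {α : Type} (enc : α → List Γ') (P : α → Prop) (f : α → Bool)
    (hf : ∀ a, f a = true ↔ P a) (p : Prog) (q : Polynomial ℕ)
    (hp : ∀ a, ∃ t ≤ q.eval (enc a).length,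
      Run p (values (enc a) []) (values [] [Γ'.bit (f a)]) t) :
    DeliveryMarket.DecidableInPolyTime enc P := by
  -- The additional step is the one at the label `none`, which outputs the answer and halts.
  have key : ∀ a, ∃ t ≤ q.eval (enc a).length, Leads (machine p).m (t + 1)
      (initList (machine p) (List.map id (enc a))) (haltList (machine p) [f a]) := by
    intro a
    obtain ⟨t, ht, hr⟩ := hp a
    obtain ⟨v, hv⟩ := hr.leads (machine p).m some none (fun _ => rfl) none
    have e := initList_machine p (List.map id (enc a))
    have e' : List.map id (enc a) = enc a := List.map_id _
    exact ⟨t, ht, Leads.trans ((congrArg (fun c => Leads (machine p).m t c _)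
      (e.trans (congrArg (fun w => TM2.Cfg.mk (some (some p.entry)) none (values w []).toStk) e'))).mpr hv)
        (Leads.single (step_machine_none p v (f a)))⟩
  exact ⟨f, hf, ⟨⟨⟨machine p, Equiv.refl _, Equiv.refl _⟩, q + 1, fun a =>
    ⟨⟨(key a).choose + 1, (key a).choose_spec.2⟩, by simpa using (key a).choose_spec.1⟩⟩⟩⟩

end StackProgram

/-! ### Step bounds and basic stack operations -/

namespace StackProgram

open Function

/-- The store with the given contents of the stacks. -/
def store (i m a t c : List Γ') : Store
  | .inp => i
  | .main => m
  | .aux => a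
  | .tmp => t
  | .cnt => c

section store

variable (i m a t c l : List Γ')

@[simp] theorem store_inp : store i m a t c .inp = i := rfl
@[simp] theorem store_main : store i m a t c .main = m := rfl
@[simp] theorem store_aux : store i m a t c .aux = a := rfl
@[simp] theorem store_tmp : store i m a t c .tmp = t := rfl
@[simp] theorem store_cnt : store i m a t c .cnt = c := rfl

@[simp] theorem update_inp : update (store i m a t c) .inp l = store l m a t c := by
  funext k; cases k <;> rfl
@[simp] theorem update_main : update (store i m a t c) .main l = store i l a t c := by
  funext k; cases k <;> rfl
@[simp] theorem update_aux : update (store i m a t c) .aux l = store i m l t c := by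
  funext k; cases k <;> rfl
@[simp] theorem update_tmp : update (store i m a t c) .tmp l = store i m a l c := by
  funext k; cases k <;> rfl
@[simp] theorem update_cnt : update (store i m a t c) .cnt l = store i m a t l := by
  funext k; cases k <;> rfl

theorem values_eq_store : values i m = store i m [] [] [] := by
  funext k; cases k <;> rfl

end store

/-- `p` leads from `S` to `S'` in at most `n` steps. -/
def Runs (p : Prog) (S S' : Store) (n : ℕ) : Prop := ∃ t ≤ n, Run p S S' t

namespace Runs

variable {p q : Prog} {S S' S'' : Store} {k : Stack} {n n' N : ℕ}

theorem mono (h : Runs p S S' n) (hN : n ≤ N) : Runs p S S' N :=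
  let ⟨t, ht, h⟩ := h
  ⟨t, ht.trans hN, h⟩

theorem skip : Runs .skip S S 1 := ⟨1, le_rfl, .skip S⟩

theorem push (k : Stack) (a : Γ') (S : Store) : Runs (.push k a) S (update S k (a :: S k)) 1 :=
  ⟨1, le_rfl, .push k a S⟩

theorem seq (h : Runs p S S' n) (h' : Runs q S' S'' n') : Runs (.seq p q) S S'' (n + n') :=
  let ⟨_, ht, h⟩ := h
  let ⟨_, ht', h'⟩ := h'
  ⟨_, add_le_add ht ht', h.seq h'⟩

theorem pop {f : Option Γ' → Prog}
    (h : Runs (f (S k).head?) (update S k (S k).tail) S' n) : Runs (.pop k f) S S' (n + 1) :=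
  let ⟨_, ht, h⟩ := h
  ⟨_, add_le_add_left ht 1, h.pop⟩

theorem exit {cond : Option Γ' → Bool} {body : Option Γ' → Prog} (h : cond (S k).head? = false) :
    Runs (.loop k cond body) S (update S k (S k).tail) 1 :=
  ⟨1, le_rfl, .exit h⟩

theorem loop {cond : Option Γ' → Bool} {body : Option Γ' → Prog} (hc : cond (S k).head? = true)
    (h : Runs (body (S k).head?) (update S k (S k).tail) S' n)
    (h' : Runs (.loop k cond body) S' S'' n') : Runs (.loop k cond body) S S'' (n + 1 + n') :=
  let ⟨_, ht, h⟩ := h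
  let ⟨_, ht', h'⟩ := h'
  ⟨_, by omega, .loop hc h h'⟩

end Runs

namespace Prog

/-- Push a word on a stack. -/
def pushAll (k : Stack) : List Γ' → Prog
  | [] => .skip
  | x :: l => .seq (pushAll k l) (.push k x)

theorem runs_pushAll (k : Stack) (l : List Γ') (S : Store) :
    Runs (pushAll k l) S (update S k (l ++ S k)) (l.length + 1) := by
  induction l with
  | nil => simpa [pushAll] using Runs.skip
  | cons x l ih => simpa [pushAll] using ih.seq (Runs.push k x _)

/-- Move the contents of a stack to another one, in reverse order. -/
abbrev pour (k k' : Stack) : Prog := .loop k Option.isSome fun o => .push k' (o.getD default)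

theorem runs_pour {k k' : Stack} (hk : k ≠ k') (l : List Γ') (S : Store) (hS : S k = l) :
    Runs (pour k k') S (update (update S k []) k' (l.reverse ++ S k')) (2 * l.length + 1) := by
  induction l generalizing S with
  | nil =>
    have h : Runs (pour k k') S _ 1 := Runs.exit (by simp [hS])
    convert h using 1
    · rw [hS, List.tail_nil, List.reverse_nil, List.nil_append, update_eq_self_iff,
        update_of_ne hk.symm]
    · rfl
  | cons x l ih =>
    have h := ih (update (update S k l) k' (x :: S k')) (by simp [hk])
    have h' : Runs (pour k k') S _ _ := Runs.loop (k := k) (by simp [hS])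
      (Runs.push k' _ _) (by simpa [hS, hk.symm] using h)
    refine Runs.mono ?_ (N := 2 * (x :: l).length + 1) (n := 1 + 1 + (2 * l.length + 1))
      (by simp; omega)
    convert h' using 1
    funext j
    by_cases h₁ : j = k'
    · subst h₁; simp
    · by_cases h₂ : j = k
      · subst h₂; simp [h₁]
      · simp [h₁, h₂]

/-- Move the contents of `aux` to `main` and to `tmp`, in reverse order. -/
abbrev pourBoth : Prog :=
  .loop .aux Option.isSome fun o => .seq (.push .main (o.getD default))
    (.push .tmp (o.getD default))

theorem runs_pourBoth (i m a t c : List Γ') :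
    Runs pourBoth (store i m a t c) (store i (a.reverse ++ m) [] (a.reverse ++ t) c)
      (3 * a.length + 1) := by
  induction a generalizing m t with
  | nil => simpa using (Runs.exit (by simp) : Runs pourBoth (store i m [] t c) _ 1)
  | cons x a ih =>
    have h : Runs pourBoth (store i m (x :: a) t c) _ _ :=
      Runs.loop (by simp) ((Runs.push .main x _).seq (Runs.push .tmp x _))
        (by simpa using ih (x :: m) (x :: t))
    refine Runs.mono (by simpa using h) (by simp; omega)

/-- Empty the stack `aux`. -/
abbrev clear : Prog := .loop .aux Option.isSome fun _ => .skip

theorem runs_clear (i m a t c : List Γ') :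
    Runs clear (store i m a t c) (store i m [] t c) (2 * a.length + 1) := by
  induction a with
  | nil => simpa using (Runs.exit (by simp) : Runs clear (store i m [] t c) _ 1)
  | cons x a ih =>
    have h : Runs clear (store i m (x :: a) t c) _ _ :=
      Runs.loop (by simp) Runs.skip (by simpa using ih)
    exact h.mono (by simp; omega)

end Prog

/-! ### Binary trees on a stack -/

/-- Binary trees, the universal data type. -/
inductive BTree
  | leaf
  | node (l r : BTree)

namespace BTree

/-- The preorder traversal of a tree. -/
def flat : BTree → List Γ'
  | leaf => [.bit false]
  | node l r => .bit true :: (l.flat ++ r.flat)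

/-- The number of nodes and leaves. -/
def size (t : BTree) : ℕ := t.flat.length

@[simp] theorem length_flat (t : BTree) : t.flat.length = t.size := rfl
@[simp] theorem size_leaf : leaf.size = 1 := rfl
@[simp] theorem size_node (l r : BTree) : (node l r).size = l.size + r.size + 1 := by
  simp only [size, flat, List.length_cons, List.length_append]

theorem size_pos (t : BTree) : 0 < t.size := by cases t <;> simp

end BTree

namespace Prog

/-- The main loop of `moveTree`; `cnt` holds one symbol for each tree that is still to be moved. -/
abbrev moveLoop : Prog :=
  .loop .cnt Option.isSome fun _ => .pop .main fun o =>
    if o = some (.bit true) then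
      .seq (.push .aux (.bit true)) (.seq (.push .cnt (.bit true)) (.push .cnt (.bit true)))
    else .push .aux (.bit false)

/-- The continuation form allows induction on `x`: a leaf uses up one pending symbol of `cnt`, a
node uses up one and adds two, for its subtrees. Each symbol of the traversal costs at most five
steps: the loop test, a pop and three pushes. -/
theorem runs_moveLoop (x : BTree) {i m a t c : List Γ'} {S : Store} {n : ℕ} (b : Γ')
    (h : Runs moveLoop (store i m (x.flat.reverse ++ a) t c) S n) :
    Runs moveLoop (store i (x.flat ++ m) a t (b :: c)) S (n + 5 * x.size) := by
  induction x generalizing m a c n b with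
  | leaf =>
    have h₁ := Runs.push .aux (.bit false) (store i m a t c)
    have : Runs moveLoop (store i (BTree.leaf.flat ++ m) a t (b :: c)) S _ := Runs.loop (by simp)
      (Runs.pop (by simpa [BTree.flat] using h₁))
      (by simpa [BTree.flat] using h)
    exact Runs.mono this (by simp; omega)
  | node l r ihl ihr =>
    have h₁ := (Runs.push .aux (.bit true) (store i (l.flat ++ (r.flat ++ m)) a t c)).seq
      ((Runs.push .cnt (.bit true) _).seq (Runs.push .cnt (.bit true) _))
    have h₂ := ihl (a := .bit true :: a) (m := r.flat ++ m) (c := .bit true :: c) (.bit true)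
      (ihr (.bit true) (by simpa [BTree.flat] using h))
    have : Runs moveLoop (store i ((l.node r).flat ++ m) a t (b :: c)) S _ := Runs.loop (by simp)
      (Runs.pop (by simpa [BTree.flat] using h₁))
      (by simpa using h₂)
    exact Runs.mono this (by simp; omega)

/-- Move the topmost tree from `main` to `aux`, in reverse order. -/
abbrev moveTree : Prog := .seq (.push .cnt (.bit true)) moveLoop

theorem runs_moveTree (x : BTree) (i m a t : List Γ') :
    Runs moveTree (store i (x.flat ++ m) a t []) (store i m (x.flat.reverse ++ a) t [])
      (5 * x.size + 2) := by
  have h : Runs moveLoop (store i m (x.flat.reverse ++ a) t []) _ 1 := Runs.exit (by simp)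
  have h' := (Runs.push .cnt (.bit true) (store i (x.flat ++ m) a t [])).seq
    (by simpa using runs_moveLoop x (.bit true) h)
  exact Runs.mono h' (by omega)

/-- Drop the topmost tree. -/
abbrev drop : Prog := .seq moveTree clear

theorem runs_drop (x : BTree) (m : List Γ') :
    Runs drop (store [] (x.flat ++ m) [] [] []) (store [] m [] [] []) (7 * x.size + 3) :=
  ((runs_moveTree x [] m [] []).seq (runs_clear ..)).mono (by simp; omega)

/-- Duplicate the topmost tree. -/
abbrev dup : Prog := .seq moveTree (.seq pourBoth (.seq (pour .tmp .aux) (pour .aux .main)))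

theorem runs_dup (x : BTree) (m : List Γ') :
    Runs dup (store [] (x.flat ++ m) [] [] []) (store [] (x.flat ++ (x.flat ++ m)) [] [] [])
      (12 * x.size + 5) := by
  have h₁ := runs_moveTree x [] m [] []
  have h₂ := runs_pourBoth [] m (x.flat.reverse ++ []) [] []
  have h₃ := runs_pour (k := .tmp) (k' := .aux) (by decide) _
    (store [] (x.flat ++ m) [] x.flat []) rfl
  have h₄ := runs_pour (k := .aux) (k' := .main) (by decide) _
    (store [] (x.flat ++ m) x.flat.reverse [] []) rfl
  simp at h₁ h₂ h₃ h₄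
  exact (h₁.seq (h₂.seq (h₃.seq h₄))).mono (by omega)

/-- Swap the two topmost trees. -/
abbrev swap : Prog :=
  .seq moveTree (.seq (pour .aux .tmp) (.seq moveTree (.seq (pour .tmp .aux) (pour .aux .main))))

theorem runs_swap (x y : BTree) (m : List Γ') :
    Runs swap (store [] (x.flat ++ (y.flat ++ m)) [] [] [])
      (store [] (y.flat ++ (x.flat ++ m)) [] [] []) (11 * (x.size + y.size) + 7) := by
  have h₁ := runs_moveTree x [] (y.flat ++ m) [] []
  have h₂ := runs_pour (k := .aux) (k' := .tmp) (by decide) _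
    (store [] (y.flat ++ m) x.flat.reverse [] []) rfl
  have h₃ := runs_moveTree y [] m [] x.flat
  have h₄ := runs_pour (k := .tmp) (k' := .aux) (by decide) _
    (store [] m y.flat.reverse x.flat []) rfl
  have h₅ := runs_pour (k := .aux) (k' := .main) (by decide) _
    (store [] m (x.flat.reverse ++ y.flat.reverse) [] []) rfl
  simp at h₁ h₂ h₃ h₄ h₅
  exact (h₁.seq (h₂.seq (h₃.seq (h₄.seq h₅)))).mono (by omega)

end Prog

end StackProgram

/-! ### Functions computable in polynomial time -/

namespace StackProgram

open Prog

/-- Types whose elements are represented by binary trees. -/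
class Data (α : Type) where
  tree : α → BTree

variable {α β γ δ : Type} [Data α] [Data β] [Data γ] [Data δ]

/-- The size of the representation. -/
def size (a : α) : ℕ := (Data.tree a).size

/-- The representation as a word. -/
def word (a : α) : List Γ' := (Data.tree a).flat

theorem size_pos (a : α) : 0 < size a := BTree.size_pos _

instance : Data Bool := ⟨fun b => bif b then .node .leaf .leaf else .leaf⟩

instance : Data (α × β) := ⟨fun p => .node (Data.tree p.1) (Data.tree p.2)⟩

/-- The tree of a list. -/
def listTree : List α → BTree
  | [] => .leaf
  | a :: l => .node (Data.tree a) (listTree l)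

instance : Data (List α) := ⟨listTree⟩

@[simp] theorem size_pair (p : α × β) : size p = size p.1 + size p.2 + 1 := BTree.size_node _ _
@[simp] theorem size_nil : size ([] : List α) = 1 := rfl
@[simp] theorem size_cons (a : α) (l : List α) : size (a :: l) = size a + size l + 1 :=
  BTree.size_node _ _

theorem size_bool_le (b : Bool) : size b ≤ 3 := by cases b <;> decide

theorem size_append (l l' : List α) : size (l ++ l') + 1 = size l + size l' := by
  induction l with
  | nil => simp; omega
  | cons a l ih => simp; omega

theorem size_le_of_mem {a : α} {l : List α} (h : a ∈ l) : size a ≤ size l := by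
  induction l with
  | nil => simp at h
  | cons b l ih =>
    rcases List.mem_cons.1 h with rfl | h
    · simp; omega
    · have := ih h; simp; omega

theorem length_lt_size (l : List α) : l.length < size l := by
  induction l with
  | nil => simp
  | cons a l ih => simp; omega

theorem size_list_le (l : List α) (n : ℕ) (h : ∀ a ∈ l, size a ≤ n) :
    size l ≤ l.length * (n + 1) + 1 := by
  induction l with
  | nil => simp
  | cons a l ih =>
    have := ih fun b hb => h b (List.mem_cons_of_mem _ hb)
    have := h a List.mem_cons_self
    simp only [size_cons, List.length_cons, add_mul]; omega

/-- Coefficients in `ℕ` are nonnegative. This is what allows a size bound to be substituted into a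
polynomial bound. -/
theorem eval_mono (q : Polynomial ℕ) : Monotone fun n => q.eval n := by
  intro m n h
  induction q using Polynomial.induction_on' with
  | add p q hp hq => simpa using add_le_add hp hq
  | monomial k a => simpa using Nat.mul_le_mul_left a (Nat.pow_le_pow_left h k)

/-- `g` is bounded by a polynomial in the size. -/
def PolyBounded (g : α → ℕ) : Prop := ∃ q : Polynomial ℕ, ∀ a, g a ≤ q.eval (size a)

namespace PolyBounded

theorem mono {g h : α → ℕ} (hh : PolyBounded h) (hg : ∀ a, g a ≤ h a) : PolyBounded g :=
  let ⟨q, hq⟩ := hh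
  ⟨q, fun a => (hg a).trans (hq a)⟩

theorem const (n : ℕ) : PolyBounded fun _ : α => n := ⟨.C n, fun a => by simp⟩

theorem id : PolyBounded fun a : α => size a := ⟨.X, fun a => by simp⟩

theorem add {g h : α → ℕ} (hg : PolyBounded g) (hh : PolyBounded h) :
    PolyBounded fun a => g a + h a :=
  let ⟨q, hq⟩ := hg
  let ⟨r, hr⟩ := hh
  ⟨q + r, fun a => by simpa using add_le_add (hq a) (hr a)⟩

theorem mul {g h : α → ℕ} (hg : PolyBounded g) (hh : PolyBounded h) :
    PolyBounded fun a => g a * h a :=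
  let ⟨q, hq⟩ := hg
  let ⟨r, hr⟩ := hh
  ⟨q * r, fun a => by simpa using Nat.mul_le_mul (hq a) (hr a)⟩

/-- A polynomial bound in terms of a quantity with a polynomial bound. -/
theorem comp_le {g : β → ℕ} (hg : PolyBounded g) {h : α → ℕ} (hh : PolyBounded h) :
    ∃ H : α → ℕ, PolyBounded H ∧ ∀ a b, size b ≤ h a → g b ≤ H a :=
  let ⟨q, hq⟩ := hg
  ⟨fun a => q.eval (h a), let ⟨r, hr⟩ := hh
    ⟨q.comp r, fun a => by simpa using eval_mono q (hr a)⟩,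
    fun _ b hb => (hq b).trans (eval_mono q hb)⟩

end PolyBounded

/-- The store with a word of values. -/
abbrev vals (m : List Γ') : Store := store [] m [] [] []

/-- `f` is computable in polynomial time: a program replaces the topmost value `a` on its stack of
values by `f a`. -/
@[fun_prop]
def PolyTime (f : α → β) : Prop :=
  ∃ (p : Prog) (B : α → ℕ), PolyBounded B ∧ ∀ a, size (f a) ≤ B a ∧
    ∀ r, Runs p (vals (word a ++ r)) (vals (word (f a) ++ r)) (B a)

namespace PolyTime

/-- The size of the value has a polynomial bound. -/
theorem polyBounded {f : α → β} (hf : PolyTime f) : PolyBounded fun a => size (f a) :=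
  let ⟨_, _, hB, h⟩ := hf
  hB.mono fun a => (h a).1

theorem polyBounded_comp {f : α → β} (hf : PolyTime f) {g : β → ℕ} (hg : PolyBounded g) :
    PolyBounded fun a => g (f a) :=
  let ⟨_, hH, h⟩ := hg.comp_le hf.polyBounded
  hH.mono fun a => h a _ le_rfl

theorem of_runs {f : α → β} (p : Prog) {B : α → ℕ} (hB : PolyBounded B)
    (hs : ∀ a, size (f a) ≤ B a)
    (h : ∀ a r, Runs p (vals (word a ++ r)) (vals (word (f a) ++ r)) (B a)) : PolyTime f :=
  ⟨p, B, hB, fun a => ⟨hs a, h a⟩⟩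

@[fun_prop]
theorem id : PolyTime fun a : α => a :=
  of_runs .skip (.add .id (.const 1)) (fun _ => Nat.le_succ _)
    fun _ _ => Runs.skip.mono (Nat.le_add_left _ _)

@[fun_prop]
theorem const (b : β) : PolyTime fun _ : α => b := by
  refine of_runs (.seq drop (pushAll .main (word b)))
    (.add (.add (.mul (.const 7) .id) (.const 3)) (.const (size b + 1))) (fun a => ?_)
    fun a r => ?_
  · omega
  · have h₁ := runs_drop (Data.tree a) r
    have h₂ := runs_pushAll .main (word b) (vals r)
    rw [update_main] at h₂
    exact h₁.seq h₂

@[fun_prop]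
theorem comp {g : β → γ} {f : α → β} (hg : PolyTime g) (hf : PolyTime f) :
    PolyTime fun a => g (f a) := by
  have hB := fun B hB => hf.polyBounded_comp (g := B) hB
  obtain ⟨p, B, hB₁, h₁⟩ := hf
  obtain ⟨p', B', hB₂, h₂⟩ := hg
  exact of_runs (.seq p p') (hB₁.add (hB _ hB₂))
    (fun a => (h₂ (f a)).1.trans (Nat.le_add_left _ _))
    fun a r => ((h₁ a).2 r).seq ((h₂ _).2 r)

/-- The program that replaces `a` by `f a, a`. -/
theorem runs_dup_apply {f : α → β} {p : Prog} {B : α → ℕ}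
    (h : ∀ a, size (f a) ≤ B a ∧ ∀ r, Runs p (vals (word a ++ r)) (vals (word (f a) ++ r)) (B a))
    (a : α) (r : List Γ') :
    Runs (.seq dup p) (vals (word a ++ r)) (vals (word (f a) ++ (word a ++ r)))
      (12 * size a + 5 + B a) :=
  (runs_dup (Data.tree a) r).seq ((h a).2 _)

@[fun_prop]
theorem prodMk {f : α → β} {g : α → γ} (hf : PolyTime f) (hg : PolyTime g) :
    PolyTime fun a => (f a, g a) := by
  obtain ⟨p, B, hB₁, h₁⟩ := hf
  obtain ⟨p', B', hB₂, h₂⟩ := hg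
  -- While `g` is evaluated on `a`, the word of `f a` lies untouched below. The last push turns two
  -- adjacent words into the word of a pair.
  refine of_runs (.seq (.seq dup p) (.seq swap (.seq p' (.seq swap (.push .main (.bit true))))))
    (.mul (.const 100) (.add (.add (.add hB₁ hB₂) .id) (.const 1)))
    (fun a => ?_) fun a r => ?_
  · have := (h₁ a).1
    have := (h₂ a).1
    simp; omega
  · have h := (runs_dup_apply h₁ a r).seq ((runs_swap _ _ r).seq (((h₂ a).2 _).seq
      ((runs_swap (Data.tree (g a)) (Data.tree (f a)) r).seq (Runs.push .main (.bit true) _))))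
    simp only [update_main, store_main] at h
    refine Runs.mono (S' := vals (word (f a, g a) ++ r)) (by
      simpa [word, Data.tree, BTree.flat] using h) ?_
    have := (h₁ a).1
    have := (h₂ a).1
    simp only [size] at *
    omega

theorem fst_aux : PolyTime fun x : α × β => x.1 := by
  refine of_runs (.pop .main fun _ => .seq swap drop) (.mul (.const 100) (.add .id (.const 1)))
    (fun x => ?_) fun x r => ?_
  · simp; omega
  · have h := (runs_swap (Data.tree x.1) (Data.tree x.2) r).seq (runs_drop _ _)
    refine (Runs.pop (S := vals (word x ++ r)) (k := .main)
      (by simpa [word, Data.tree, BTree.flat] using h)).mono ?_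
    have := size_pair x
    simp only [size] at *; omega

theorem snd_aux : PolyTime fun x : α × β => x.2 := by
  refine of_runs (.pop .main fun _ => drop) (.mul (.const 100) (.add .id (.const 1)))
    (fun x => ?_) fun x r => ?_
  · simp; omega
  · have h := runs_drop (Data.tree x.1) (word x.2 ++ r)
    refine (Runs.pop (S := vals (word x ++ r)) (k := .main)
      (by simpa [word, Data.tree, BTree.flat] using h)).mono ?_
    have := size_pair x
    simp only [size] at *; omega

@[fun_prop]
theorem fst {f : α → β × γ} (hf : PolyTime f) : PolyTime fun a => (f a).1 := fst_aux.comp hf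

@[fun_prop]
theorem snd {f : α → β × γ} (hf : PolyTime f) : PolyTime fun a => (f a).2 := snd_aux.comp hf

/-- A function between types with the same representations. -/
theorem of_tree_eq {f : α → β} (h : ∀ a, Data.tree (f a) = Data.tree a) : PolyTime f := by
  refine of_runs .skip (.add .id (.const 1)) (fun a => ?_) fun a r => ?_
  · simp [size, h]
  · have : word (f a) = word a := by rw [word, h, word]
    rw [this]
    exact Runs.skip.mono (Nat.le_add_left _ _)

@[fun_prop]
theorem cons {f : α → β} {g : α → List β} (hf : PolyTime f) (hg : PolyTime g) :
    PolyTime fun a => f a :: g a :=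
  (of_tree_eq (f := fun p : β × List β => p.1 :: p.2) fun _ => rfl).comp (hf.prodMk hg)

@[fun_prop]
theorem cond {c : α → Bool} {f g : α → β} (hc : PolyTime c) (hf : PolyTime f) (hg : PolyTime g) :
    PolyTime fun a => bif c a then f a else g a := by
  obtain ⟨p, B, hB₁, h₁⟩ := hc
  obtain ⟨p', B', hB₂, h₂⟩ := hf
  obtain ⟨p'', B'', hB₃, h₃⟩ := hg
  -- `true` is a node with two leaves, so two more symbols have to be popped; `false` is a single
  -- leaf.
  refine of_runs (.seq (.seq dup p) (.pop .main fun o =>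
      if o = some (.bit true) then .pop .main fun _ => .pop .main fun _ => p' else p''))
    (.mul (.const 100) (.add (.add (.add (.add hB₁ hB₂) hB₃) .id) (.const 1)))
    (fun a => ?_) fun a r => ?_
  · have := (h₂ a).1
    have := (h₃ a).1
    cases c a <;> simp <;> omega
  · have h := runs_dup_apply h₁ a r
    cases hc : c a
    · rw [hc] at h
      refine (h.seq (Runs.pop (by
        simpa [word, Data.tree, BTree.flat] using (h₃ a).2 r))).mono ?_
      omega
    · rw [hc] at h
      refine (h.seq (Runs.pop (n := B' a + 1 + 1) ?_)).mono ?_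
      · have := Runs.pop (k := .main) (f := fun _ => .pop .main fun _ => p')
          (S := vals (.bit false :: .bit false :: (word a ++ r)))
          (Runs.pop (by simpa using (h₂ a).2 r))
        simpa [word, Data.tree, BTree.flat] using this
      · omega

/-- A nonempty list and the pair of its head and tail have the same word. After the test, restoring
the node symbol, swapping with `a` and adding one more node symbol produces the word of `(a, b, t)`.
-/
theorem list_cases {l : α → List β} {g : α → γ} {h : α → β → List β → γ} (hl : PolyTime l)
    (hg : PolyTime g) (hh : PolyTime fun p : α × β × List β => h p.1 p.2.1 p.2.2) :
    PolyTime fun a => match l a with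
      | [] => g a
      | b :: t => h a b t := by
  have hB := fun B hB => PolyBounded.comp_le (β := α × β × List β) (g := B) hB
    (h := fun a => size a + size (l a) + 1) (.add (.add .id hl.polyBounded) (.const 1))
  have hls := hl.polyBounded
  obtain ⟨p, B, hB₁, h₁⟩ := hl
  obtain ⟨p', B', hB₂, h₂⟩ := hg
  obtain ⟨p'', B'', hB₃, h₃⟩ := hh
  obtain ⟨H, hH, hH'⟩ := hB _ hB₃
  refine of_runs (.seq (.seq dup p) (.pop .main fun o =>
      if o = some (.bit true) then .seq (.push .main (.bit true)) (.seq swap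
        (.seq (.push .main (.bit true)) p'')) else p'))
    (.mul (.const 100) (.add (.add (.add (.add (.add hB₁ hB₂) hH) .id) hls) (.const 1)))
    (fun a => ?_) fun a r => ?_
  · have h₂' := (h₂ a).1
    cases hl : l a with
    | nil => simp only; omega
    | cons b t =>
      have := (h₃ (a, b, t)).1
      have := hH' a (a, b, t) (by simp [hl])
      dsimp only at *; omega
  · have h := runs_dup_apply h₁ a r
    cases hl : l a with
    | nil =>
      rw [hl] at h
      refine (h.seq (Runs.pop (by
        simpa [word, Data.tree, BTree.flat, listTree] using (h₂ a).2 r))).mono ?_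
      omega
    | cons b t =>
      rw [hl] at h
      have e₁ := Runs.push .main (.bit true) (vals (word b ++ (word t ++ (word a ++ r))))
      have e₂ := runs_swap (.node (Data.tree b) (Data.tree t)) (Data.tree a) r
      have e₃ := Runs.push .main (.bit true) (vals (word a ++ (word (b, t) ++ r)))
      have e₄ := (h₃ (a, b, t)).2 r
      simp only [word, Data.tree, BTree.flat, listTree, update_main, store_main, List.cons_append,
        List.append_assoc] at e₁ e₂ e₃ e₄ h
      refine (h.seq (Runs.pop (by simpa [word] using e₁.seq (e₂.seq (e₃.seq e₄))))).mono ?_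
      have := hH' a (a, b, t) (by simp [hl])
      have := size_cons b t
      have : (listTree t).size = (Data.tree t).size := rfl
      simp only [size, BTree.size_node, hl] at *
      omega

end PolyTime

end StackProgram

/-! ### Iteration, folds and list functions -/

namespace StackProgram

open Prog

variable {α β γ δ : Type} [Data α] [Data β] [Data γ] [Data δ]

/-- Apply `p` to the second value once for each element of the list that is the first value. -/
abbrev Prog.iter (p : Prog) : Prog :=
  .loop .main (fun o => decide (o = some (.bit true))) fun _ =>
    .seq drop (.seq swap (.seq p swap))

/-- The list is its own loop counter: a node symbol starts a round, which drops the element and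
reaches the second value by a swap, and the final leaf is consumed by the test that ends the loop.
The factor 40 covers the drop, the two swaps and the run of `p` in one round. -/
theorem runs_iter {s : β → β} {p : Prog} {T : β → ℕ}
    (h : ∀ b r, Runs p (vals (word b ++ r)) (vals (word (s b) ++ r)) (T b)) (r : List Γ')
    (N B M : ℕ) (l : List γ) (b : β) (hl : size l ≤ N)
    (hb : ∀ k ≤ l.length, size (s^[k] b) ≤ B ∧ T (s^[k] b) ≤ M) :
    Runs (iter p) (vals (word l ++ (word b ++ r))) (vals (word (s^[l.length] b) ++ r))
      (l.length * (40 * (N + B + M + 1)) + 1) := by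
  induction l generalizing b with
  | nil =>
    have : Runs (iter p) (vals (word ([] : List γ) ++ (word b ++ r))) _ 1 :=
      Runs.exit (by simp [word, Data.tree, listTree, BTree.flat])
    simpa [word, Data.tree, listTree, BTree.flat] using this
  | cons c l ih =>
    have hc := size_cons c l
    have h₀ := hb 0 (by simp)
    have h₁ := hb 1 (by simp)
    simp only [Function.iterate_zero, _root_.id, Function.iterate_one] at h₀ h₁
    have ih := ih (s b) (by omega) fun k hk => by simpa using hb (k + 1) (by simpa using hk)
    have e := (runs_drop (Data.tree c) (word l ++ (word b ++ r))).seq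
      ((runs_swap (Data.tree l) (Data.tree b) r).seq ((h b _).seq
        (runs_swap (Data.tree (s b)) (Data.tree l) r)))
    have : Runs (iter p) (vals (word (c :: l) ++ (word b ++ r))) _ _ :=
      Runs.loop (by simp [word, Data.tree, listTree, BTree.flat])
        (by simpa [word, Data.tree, listTree, BTree.flat] using e) ih
    refine this.mono ?_
    simp only [size] at *
    have : (listTree l).size = (Data.tree l).size := rfl
    simp only [List.length_cons, add_mul, one_mul]
    omega

namespace PolyTime

theorem congr' {f g : α → β} (hf : PolyTime f) (h : ∀ a, f a = g a) : PolyTime g := funext h ▸ hf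

/-- Iteration with polynomially bounded values. -/
theorem iterate {n : α → List γ} {i : α → β} {s : β → β} (hn : PolyTime n) (hi : PolyTime i)
    (hs : PolyTime s) {B : α → ℕ} (hB : PolyBounded B)
    (h : ∀ a, ∀ k ≤ (n a).length, size (s^[k] (i a)) ≤ B a) :
    PolyTime fun a => s^[(n a).length] (i a) := by
  have hns := hn.polyBounded
  obtain ⟨p, T, hT, h₁⟩ := hn
  obtain ⟨p', T', hT', h₂⟩ := hi
  obtain ⟨p'', T'', hT'', h₃⟩ := hs
  obtain ⟨M, hM, hM'⟩ := hT''.comp_le hB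
  refine of_runs (.seq (.seq dup p') (.seq swap (.seq p p''.iter)))
    (.add (.mul hns (.mul (.const 40) (.add (.add (.add hns hB) hM) (.const 1))))
      (.mul (.const 40) (.add (.add (.add (.add hT hT') hB) .id) (.const 1))))
    (fun a => ?_) fun a r => ?_
  · have := h a _ le_rfl
    generalize size (n a) * _ = x
    omega
  · have := runs_iter (fun b => (h₃ b).2) r (size (n a)) (B a) (M a) (n a) (i a) le_rfl
      fun k hk => ⟨h a k hk, hM' a _ (h a k hk)⟩
    refine ((runs_dup_apply h₂ a r).seq ((runs_swap (Data.tree (i a)) (Data.tree a) r).seq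
      (((h₁ a).2 _).seq this))).mono ?_
    have h₀ := h a 0 (Nat.zero_le _)
    have := Nat.mul_le_mul_right (40 * (size (n a) + B a + M a + 1)) (length_lt_size (n a)).le
    simp only [Function.iterate_zero, _root_.id, size] at *
    omega

/-- Folding over a list with polynomially bounded values. -/
theorem foldl {f : α → δ → γ → δ} {i : α → δ} {l : α → List γ} (hl : PolyTime l)
    (hi : PolyTime i) (hf : PolyTime fun p : α × δ × γ => f p.1 p.2.1 p.2.2) {B : α → ℕ}
    (hB : PolyBounded B) (h : ∀ a l', l' <+: l a → size (l'.foldl (f a) (i a)) ≤ B a) :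
    PolyTime fun a => (l a).foldl (f a) (i a) := by
  -- The state carries the rest of the list. The number of iterations is the length of that list, so
  -- the empty case is never reached.
  let s : α × δ × List γ → α × δ × List γ := fun x =>
    match x.2.2 with
    | [] => x
    | c :: t => (x.1, f x.1 x.2.1 c, t)
  have hs : PolyTime s := list_cases (h := fun (x : α × δ × List γ) c t => (x.1, f x.1 x.2.1 c, t))
    (by fun_prop) .id <| .prodMk (by fun_prop) <| .prodMk
      (hf.comp (f := fun p : (α × δ × List γ) × γ × List γ => (p.1.1, p.1.2.1, p.2.1))
        (by fun_prop)) (by fun_prop)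
  have key : ∀ (a : α) (d : δ) (L : List γ) (k : ℕ), k ≤ L.length →
      s^[k] (a, d, L) = (a, (L.take k).foldl (f a) d, L.drop k) := by
    intro a d L k
    induction k generalizing d L with
    | zero => simp
    | succ k ih =>
      cases L with
      | nil => simp
      | cons c L =>
        intro hk
        rw [Function.iterate_succ_apply]
        simpa using ih (f a d c) L (by simpa using hk)
  have := iterate (i := fun a => (a, i a, l a)) hl (by fun_prop) hs
    (B := fun a => size a + B a + size (l a) + 2)
    (.add (.add (.add .id hB) hl.polyBounded) (.const 2)) fun a k hk => ?_
  · refine (PolyTime.fst (PolyTime.snd this)).congr' fun a => ?_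
    simp [key]
  · rw [key _ _ _ _ hk]
    have := h a _ (List.take_prefix k (l a))
    have h' : size ((l a).drop k) ≤ size (l a) := by
      have h₁ := size_append ((l a).take k) ((l a).drop k)
      have := size_pos ((l a).take k)
      rw [List.take_append_drop] at h₁
      omega
    simp only [size_pair]
    omega

/-- Folding over a list when each step adds a polynomially bounded amount to a measure `μ` of the
size. -/
theorem foldl_of_add' {f : α → δ → γ → δ} {i : α → δ} {l : α → List γ} (μ : δ → ℕ)
    (hμ : ∀ d, μ d ≤ size d) (hμ' : ∀ d, size d ≤ 4 * μ d + 1) (hl : PolyTime l)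
    (hi : PolyTime i) (hf : PolyTime fun p : α × δ × γ => f p.1 p.2.1 p.2.2) {G : α → ℕ}
    (hG : PolyBounded G) (h : ∀ a, ∀ c ∈ l a, ∀ d, μ (f a d c) ≤ μ d + G a) :
    PolyTime fun a => (l a).foldl (f a) (i a) := by
  -- Growth is measured by `μ` during the whole fold and converted to `size` only at the end; losing
  -- the factor 4 in every step would be exponential.
  refine foldl hl hi hf (B := fun a => 4 * (size (i a) + size (l a) * G a) + 1)
    (.add (.mul (.const 4) (.add hi.polyBounded (.mul hl.polyBounded hG))) (.const 1))
    fun a l' hl' => ?_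
  have key : ∀ (L : List γ) (d : δ), (∀ c ∈ L, c ∈ l a) →
      μ (L.foldl (f a) d) ≤ μ d + L.length * G a := by
    intro L
    induction L with
    | nil => simp
    | cons c L ih =>
      intro d hL
      have h₁ := h a c (hL c List.mem_cons_self) d
      have h₂ := ih (f a d c) fun c' hc' => hL c' (List.mem_cons_of_mem _ hc')
      simp only [List.foldl_cons, List.length_cons, add_mul] at *
      omega
  have h₁ := key l' (i a) hl'.subset
  have h₂ := hμ (i a)
  have h₃ := hμ' (l'.foldl (f a) (i a))
  have := hl'.length_le
  have := length_lt_size (l a)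
  have := Nat.mul_le_mul_right (G a) (show l'.length ≤ size (l a) by omega)
  omega

/-- Folding over a list when each step adds a polynomially bounded amount to the size. -/
theorem foldl_of_add {f : α → δ → γ → δ} {i : α → δ} {l : α → List γ} (hl : PolyTime l)
    (hi : PolyTime i) (hf : PolyTime fun p : α × δ × γ => f p.1 p.2.1 p.2.2) {G : α → ℕ}
    (hG : PolyBounded G) (h : ∀ a, ∀ c ∈ l a, ∀ d, size (f a d c) ≤ size d + G a) :
    PolyTime fun a => (l a).foldl (f a) (i a) :=
  foldl_of_add' size (fun _ => le_rfl) (fun _ => by omega) hl hi hf hG h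

theorem reverse_aux : PolyTime fun l : List γ => l.reverse := by
  have := foldl_of_add (α := List γ) (f := fun _ s c => c :: s) (i := fun _ => []) (l := fun l => l)
    .id (.const _) (by fun_prop) (G := fun l => size l + 1) (.add .id (.const 1)) fun l c hc d => by
      have := size_le_of_mem hc
      simp; omega
  exact this.congr' fun l => by simp

@[fun_prop]
theorem reverse {l : α → List γ} (hl : PolyTime l) : PolyTime fun a => (l a).reverse :=
  reverse_aux.comp hl

theorem map {f : α → γ → δ} {l : α → List γ} (hl : PolyTime l)
    (hf : PolyTime fun p : α × γ => f p.1 p.2) : PolyTime fun a => (l a).map (f a) := by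
  obtain ⟨G, hG, hG'⟩ := hf.polyBounded.comp_le (α := α) (h := fun a => size a + size (l a) + 1)
    (.add (.add .id hl.polyBounded) (.const 1))
  have := foldl_of_add (f := fun a s c => f a c :: s) (i := fun _ => []) hl (.const _)
    (.cons (hf.comp (f := fun p : α × List δ × γ => (p.1, p.2.2)) (by fun_prop)) (by fun_prop))
    (G := fun a => G a + 1) (.add hG (.const 1)) fun a c hc d => by
      have := hG' a (a, c) (by have := size_le_of_mem hc; simp; omega)
      simp at *; omega
  refine this.reverse.congr' fun a => ?_
  have : ∀ (L : List γ) (d : List δ), L.foldl (fun s c => f a c :: s) d =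
      (L.map (f a)).reverse ++ d := by
    intro L
    induction L with
    | nil => simp
    | cons c L ih => simp [ih]
  simp [this]

@[fun_prop]
theorem append {f g : α → List γ} (hf : PolyTime f) (hg : PolyTime g) :
    PolyTime fun a => f a ++ g a := by
  have := foldl_of_add (f := fun _ s c => c :: s) hf.reverse hg (by fun_prop)
    (G := fun a => size (f a) + 1) (.add hf.polyBounded (.const 1)) fun a c hc d => by
      have := size_le_of_mem (List.mem_reverse.1 hc)
      simp; omega
  exact this.congr' fun a => by simp [List.foldl_reverse]

theorem flatMap {f : α → γ → List δ} {l : α → List γ} (hl : PolyTime l)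
    (hf : PolyTime fun p : α × γ => f p.1 p.2) : PolyTime fun a => (l a).flatMap (f a) := by
  have hm := map hl hf
  have := foldl_of_add (f := fun _ s (c : List δ) => s ++ c) (i := fun _ => []) hm (.const _)
    (by fun_prop) (G := fun a => size ((l a).map (f a))) hm.polyBounded fun a c hc d => by
      have := size_le_of_mem hc
      have := size_append d c
      omega
  refine this.congr' fun a => ?_
  have : ∀ (L : List (List δ)) (d : List δ), L.foldl (fun s c => s ++ c) d = d ++ L.flatten := by
    intro L
    induction L with
    | nil => simp
    | cons c L ih => simp [ih]
  simp [this, List.flatMap_def]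

@[fun_prop]
theorem and {f g : α → Bool} (hf : PolyTime f) (hg : PolyTime g) :
    PolyTime fun a => f a && g a :=
  (hf.cond hg (.const false)).congr' fun a => by cases f a <;> rfl

theorem all {f : α → γ → Bool} {l : α → List γ} (hl : PolyTime l)
    (hf : PolyTime fun p : α × γ => f p.1 p.2) : PolyTime fun a => (l a).all (f a) := by
  have := foldl (f := fun a s c => s && f a c) (i := fun _ => true) hl (.const _)
    (.and (by fun_prop) (hf.comp (f := fun p : α × Bool × γ => (p.1, p.2.2)) (by fun_prop)))
    (B := fun _ => 3) (.const 3) fun a l' _ => size_bool_le _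
  refine this.congr' fun a => ?_
  have : ∀ (L : List γ) (d : Bool), L.foldl (fun s c => s && f a c) d =
      (d && L.all (f a)) := by
    intro L
    induction L with
    | nil => simp
    | cons c L ih => intro d; simp [ih, Bool.and_assoc]
  simp [this]

@[fun_prop]
theorem not {f : α → Bool} (hf : PolyTime f) : PolyTime fun a => !f a :=
  (hf.cond (.const false) (.const true)).congr' fun a => by cases f a <;> rfl

@[fun_prop]
theorem xor {f g : α → Bool} (hf : PolyTime f) (hg : PolyTime g) :
    PolyTime fun a => Bool.xor (f a) (g a) :=
  (hf.cond hg.not hg).congr' fun a => by cases f a <;> simp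

@[fun_prop]
theorem or {f g : α → Bool} (hf : PolyTime f) (hg : PolyTime g) :
    PolyTime fun a => f a || g a :=
  (hf.cond (.const true) hg).congr' fun a => by cases f a <;> rfl

theorem isEmpty_aux : PolyTime fun l : List γ => l.isEmpty :=
  (list_cases (l := fun l : List γ => l) (g := fun _ => true) (h := fun _ _ _ => false) .id
    (.const _) (.const _)).congr' fun l => by cases l <;> rfl

theorem tail_aux : PolyTime fun l : List γ => l.tail :=
  (list_cases (l := fun l : List γ => l) (g := fun _ => []) (h := fun _ _ t => t) .id
    (.const _) (by fun_prop)).congr' fun l => by cases l <;> rfl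

theorem headD_aux : PolyTime fun p : List γ × γ => p.1.headD p.2 :=
  (list_cases (l := fun p : List γ × γ => p.1) (g := fun p => p.2) (h := fun _ c _ => c)
    (by fun_prop) (by fun_prop) (by fun_prop)).congr' fun p => by rcases p with ⟨- | _, _⟩ <;> rfl

@[fun_prop]
theorem isEmpty {l : α → List γ} (hl : PolyTime l) : PolyTime fun a => (l a).isEmpty :=
  isEmpty_aux.comp hl

@[fun_prop]
theorem tail {l : α → List γ} (hl : PolyTime l) : PolyTime fun a => (l a).tail := tail_aux.comp hl

@[fun_prop]
theorem headD {l : α → List γ} {d : α → γ} (hl : PolyTime l) (hd : PolyTime d) :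
    PolyTime fun a => (l a).headD (d a) := headD_aux.comp (hl.prodMk hd)

end PolyTime

end StackProgram

namespace StackProgram

variable {α β γ δ : Type} [Data α] [Data β] [Data γ] [Data δ]

/-! ### Arithmetic of natural numbers -/

instance : Data ℕ := ⟨fun n => listTree n.bits⟩

theorem size_list_bool_le (l : List Bool) : size l ≤ 4 * l.length + 1 := by
  have := size_list_le l 3 fun b _ => size_bool_le b
  omega

theorem size_nat_le (n : ℕ) : size n ≤ 4 * n.size + 1 := by
  have : size n = size n.bits := rfl
  rw [this, ← Nat.size_eq_bits_len]
  exact size_list_bool_le _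

theorem nat_size_lt (n : ℕ) : n.size < size n := by
  have : size n = size n.bits := rfl
  rw [this, ← Nat.size_eq_bits_len]
  exact length_lt_size _

theorem size_nat_mono {m n : ℕ} (h : m ≤ n) : size m ≤ 4 * size n := by
  have := size_nat_le m
  have := nat_size_lt n
  have := Nat.size_le_size h
  omega

theorem nat_size_add_le (m n : ℕ) : (m + n).size ≤ m.size + n.size + 1 := by
  rw [Nat.size_le]
  have hm := m.lt_size_self
  have hn := n.lt_size_self
  have h₁ := Nat.pow_le_pow_right (n := 2) (by simp) (Nat.le_add_right m.size n.size)
  have h₂ := Nat.pow_le_pow_right (n := 2) (by simp) (Nat.le_add_left n.size m.size)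
  rw [pow_succ]
  omega

theorem nat_size_mul_le (m n : ℕ) : (m * n).size ≤ m.size + n.size := by
  rw [Nat.size_le, pow_add]
  exact Nat.mul_lt_mul'' m.lt_size_self n.lt_size_self

/-- The number with the given binary digits, the least significant first. -/
def ofDigits (l : List Bool) : ℕ := l.foldr Nat.bit 0

@[simp] theorem ofDigits_nil : ofDigits [] = 0 := rfl
@[simp] theorem ofDigits_cons (b : Bool) (l : List Bool) :
    ofDigits (b :: l) = 2 * ofDigits l + b.toNat := Nat.bit_val _ _

theorem ofDigits_append (l l' : List Bool) :
    ofDigits (l ++ l') = ofDigits l + 2 ^ l.length * ofDigits l' := by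
  induction l with
  | nil => simp
  | cons b l ih => simp [ih, pow_succ]; ring

theorem ofDigits_bits (n : ℕ) : ofDigits n.bits = n := by
  induction n using Nat.binaryRec' with
  | zero => simp
  | bit b n h ih => rw [Nat.bits_append_bit _ _ h, ofDigits_cons, ih, Nat.bit_val]

/-- A digitwise operation with a carry: `δ` maps the carry and two digits to the new carry and
digit.  The list only counts the digits. -/
def digitwise (δ : Bool → Bool → Bool → Bool × Bool) (L : List Bool)
    (s : ℕ × ℕ × Bool × List Bool) : ℕ × ℕ × Bool × List Bool :=
  L.foldl (fun s _ => (s.1.div2, s.2.1.div2, (δ s.2.2.1 s.1.bodd s.2.1.bodd).1,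
    (δ s.2.2.1 s.1.bodd s.2.1.bodd).2 :: s.2.2.2)) s

/-- One invariant serves for addition (`ε = 1`, carry) and subtraction (`ε = -1`, borrow): the carry
always has the sign of the second operand. Digits come out least significant first, hence reversed
in the accumulator. -/
theorem digitwise_spec (δ : Bool → Bool → Bool → Bool × Bool) (ε : ℤ)
    (hδ : ∀ c x y, ((δ c x y).2.toNat : ℤ) + 2 * ε * ((δ c x y).1.toNat : ℤ) =
      (x.toNat : ℤ) + ε * y.toNat + ε * c.toNat) (L : List Bool) (x y : ℕ) (c : Bool)
    (o : List Bool) (hx : x < 2 ^ L.length) (hy : y < 2 ^ L.length) :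
    ∃ w, w.length = L.length ∧ (digitwise δ L (x, y, c, o)).2.2.2 = w.reverse ++ o ∧
      (ofDigits w : ℤ) + 2 ^ L.length * ε * (digitwise δ L (x, y, c, o)).2.2.1.toNat =
        x + ε * y + ε * c.toNat := by
  induction L generalizing x y c o with
  | nil =>
    have hx : x = 0 := by simpa using hx
    have hy : y = 0 := by simpa using hy
    exact ⟨[], by simp [digitwise, hx, hy]⟩
  | cons b L ih =>
    have ex := Nat.bodd_add_div2 x
    have ey := Nat.bodd_add_div2 y
    rw [List.length_cons, pow_succ] at hx hy
    obtain ⟨w, hw, ho, h⟩ := ih x.div2 y.div2 (δ c x.bodd y.bodd).1 ((δ c x.bodd y.bodd).2 :: o)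
      (by omega) (by omega)
    refine ⟨(δ c x.bodd y.bodd).2 :: w, by simp [hw], by simpa [digitwise] using ho, ?_⟩
    have hd := hδ c x.bodd y.bodd
    have e : digitwise δ (b :: L) (x, y, c, o) = digitwise δ L (x.div2, y.div2,
      (δ c x.bodd y.bodd).1, (δ c x.bodd y.bodd).2 :: o) := rfl
    rw [e, ofDigits_cons, List.length_cons, pow_succ]
    have ex' : (x : ℤ) = x.bodd.toNat + 2 * x.div2 := by exact_mod_cast ex.symm
    have ey' : (y : ℤ) = y.bodd.toNat + 2 * y.div2 := by exact_mod_cast ey.symm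
    push_cast
    linear_combination 2 * h + hd - ex' - ε * ey'

/-- Addition of digits with a carry. -/
def addDigit (c x y : Bool) : Bool × Bool :=
  (bif c then x || y else x && y, Bool.xor c (Bool.xor x y))

/-- Subtraction of digits with a borrow. -/
def subDigit (c x y : Bool) : Bool × Bool :=
  (bif x then c && y else c || y, Bool.xor c (Bool.xor x y))

theorem lt_two_pow_bits (x y : ℕ) :
    x < 2 ^ (x.bits ++ y.bits).length ∧ y < 2 ^ (x.bits ++ y.bits).length := by
  rw [List.length_append, Nat.size_eq_bits_len, Nat.size_eq_bits_len, ← Nat.size_le, ← Nat.size_le]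
  omega

theorem digitwise_add (x y : ℕ) :
    ofDigits ((digitwise addDigit (x.bits ++ y.bits) (x, y, false, [])).2.2.1 ::
      (digitwise addDigit (x.bits ++ y.bits) (x, y, false, [])).2.2.2).reverse = x + y := by
  obtain ⟨w, hw, ho, h⟩ := digitwise_spec addDigit 1 (by decide) (x.bits ++ y.bits) x y false []
    (lt_two_pow_bits x y).1 (lt_two_pow_bits x y).2
  rw [ho, ← hw] at *
  simp only [List.append_nil, List.reverse_cons, List.reverse_reverse, ofDigits_append,
    ofDigits_cons, ofDigits_nil]
  rw [Bool.toNat_false, Nat.cast_zero] at h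
  zify
  linear_combination h

/-- A borrow left at the end means `x < y`, where truncated subtraction gives zero. -/
theorem digitwise_sub (x y : ℕ) :
    (bif (digitwise subDigit (x.bits ++ y.bits) (x, y, false, [])).2.2.1 then 0 else
      ofDigits (digitwise subDigit (x.bits ++ y.bits) (x, y, false, [])).2.2.2.reverse) =
      x - y := by
  obtain ⟨w, hw, ho, h⟩ := digitwise_spec subDigit (-1) (by decide) (x.bits ++ y.bits) x y false []
    (lt_two_pow_bits x y).1 (lt_two_pow_bits x y).2
  have hlt : ∀ w : List Bool, ofDigits w < 2 ^ w.length := by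
    intro w
    induction w with
    | nil => simp
    | cons b w ih => have := b.toNat_lt; simp [pow_succ]; omega
  have hlt : (ofDigits w : ℤ) < 2 ^ (x.bits ++ y.bits).length := by exact_mod_cast hw ▸ hlt w
  rw [ho]
  cases hc : (digitwise subDigit (x.bits ++ y.bits) (x, y, false, [])).2.2.1
  · rw [hc] at h
    simp at h ⊢
    omega
  · rw [hc] at h
    simp only [Bool.toNat_true, Nat.cast_one, Bool.toNat_false, Nat.cast_zero] at h
    simp only [cond_true]
    omega

namespace PolyTime

theorem bits_aux : PolyTime fun n : ℕ => n.bits := of_tree_eq fun _ => rfl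

@[fun_prop]
theorem bits {f : α → ℕ} (hf : PolyTime f) : PolyTime fun a => (f a).bits := bits_aux.comp hf

/-- A natural number may be computed by its list of digits. -/
theorem of_bits {f : α → ℕ} (hf : PolyTime fun a => (f a).bits) : PolyTime f := hf

@[fun_prop]
theorem bodd {f : α → ℕ} (hf : PolyTime f) : PolyTime fun a => (f a).bodd :=
  (headD (bits hf) (const false)).congr' fun a => by
    rw [Nat.bodd_eq_bits_head]; cases (f a).bits <;> rfl

@[fun_prop]
theorem div2 {f : α → ℕ} (hf : PolyTime f) : PolyTime fun a => (f a).div2 :=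
  of_bits ((tail (bits hf)).congr' fun _ => (Nat.div2_bits_eq_tail _).symm)

@[fun_prop]
theorem bit {b : α → Bool} {f : α → ℕ} (hb : PolyTime b) (hf : PolyTime f) :
    PolyTime fun a => Nat.bit (b a) (f a) := by
  -- A zero digit must not be put before the empty list of digits, since zero is represented by no
  -- digits at all.
  refine of_bits ((cond (c := fun a => (f a).bits.isEmpty && !(b a)) (by fun_prop) (const [])
    (cons hb (bits hf))).congr' fun a => ?_)
  by_cases h : f a = 0 → b a = true
  · rw [Nat.bits_append_bit _ _ h]
    cases hb : b a
    · have : (f a).bits ≠ [] := fun e => by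
        have := ofDigits_bits (f a)
        rw [e] at this
        simpa [hb] using h this.symm
      cases hf : (f a).bits <;> simp_all
    · simp
  · push Not at h
    obtain ⟨h, h'⟩ := h
    simp [h, h', Nat.bit]

theorem ofDigits_aux : PolyTime fun l : List Bool => ofDigits l := by
  have := foldl_of_add' (α := List Bool) (f := fun _ n b => Nat.bit b n) (i := fun _ => 0)
    (l := fun l => l.reverse) Nat.size (fun n => (nat_size_lt n).le) size_nat_le (by fun_prop)
    (.const _) (by fun_prop) (G := fun _ => 1) (.const 1) fun _ b _ n => by
      rw [Nat.size_le, Nat.bit_val, pow_succ]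
      have := n.lt_size_self
      have := b.toNat_lt
      omega
  exact this.congr' fun l => by simp [ofDigits, List.foldl_reverse]

@[fun_prop]
theorem ofDigits {l : α → List Bool} (hl : PolyTime l) : PolyTime fun a => ofDigits (l a) :=
  ofDigits_aux.comp hl

theorem digitwise {d : Bool → Bool → Bool → Bool × Bool}
    (hd : PolyTime fun p : Bool × Bool × Bool => d p.1 p.2.1 p.2.2) {f g : α → ℕ}
    (hf : PolyTime f) (hg : PolyTime g) : PolyTime fun a =>
      digitwise d ((f a).bits ++ (g a).bits) (f a, g a, false, []) := by
  have hd' := fun (i : α × (ℕ × ℕ × Bool × List Bool) × Bool → Bool × Bool × Bool) hi =>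
    hd.comp (f := i) hi
  have := hd' (fun p => (p.2.1.2.2.1, p.2.1.1.bodd, p.2.1.2.1.bodd)) (by fun_prop)
  refine foldl_of_add (f := fun _ (s : ℕ × ℕ × Bool × List Bool) (_ : Bool) =>
    (s.1.div2, s.2.1.div2, (d s.2.2.1 s.1.bodd s.2.1.bodd).1,
      (d s.2.2.1 s.1.bodd s.2.1.bodd).2 :: s.2.2.2)) (by fun_prop) (by fun_prop) ?_
    (G := fun _ => 10) (.const _) fun a c _ s => ?_
  · exact prodMk (by fun_prop) <| prodMk (by fun_prop) <| prodMk (fst this) <|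
      cons (snd this) (by fun_prop)
  · have h : ∀ n : ℕ, size n.div2 ≤ size n := fun n => by
      have e : size n.div2 = size n.bits.tail := by rw [← Nat.div2_bits_eq_tail]; rfl
      have e' : size n = size n.bits := rfl
      rw [e, e']
      cases n.bits <;> simp
      omega
    have := h s.1
    have := h s.2.1
    have := size_bool_le (d s.2.2.1 s.1.bodd s.2.1.bodd).1
    have := size_bool_le (d s.2.2.1 s.1.bodd s.2.1.bodd).2
    simp only [size_pair, size_cons]
    omega

@[fun_prop]
theorem add {f g : α → ℕ} (hf : PolyTime f) (hg : PolyTime g) : PolyTime fun a => f a + g a := by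
  have := digitwise (d := addDigit) (by unfold addDigit; fun_prop) hf hg
  exact PolyTime.congr' (by fun_prop) fun a => digitwise_add (f a) (g a)

@[fun_prop]
theorem sub {f g : α → ℕ} (hf : PolyTime f) (hg : PolyTime g) : PolyTime fun a => f a - g a := by
  have := digitwise (d := subDigit) (by unfold subDigit; fun_prop) hf hg
  exact PolyTime.congr' (by fun_prop) fun a => digitwise_sub (f a) (g a)

@[fun_prop]
theorem ble {f g : α → ℕ} (hf : PolyTime f) (hg : PolyTime g) :
    PolyTime fun a => Nat.ble (f a) (g a) :=
  PolyTime.congr' (f := fun a => (f a - g a).bits.isEmpty) (by fun_prop) fun a => by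
    rw [Bool.eq_iff_iff, Nat.ble_eq, List.isEmpty_iff, ← Nat.sub_eq_zero_iff_le]
    refine ⟨fun h => ?_, fun h => by simp [h]⟩
    rw [← ofDigits_bits (f a - g a), h, ofDigits_nil]

@[fun_prop]
theorem beq {f g : α → ℕ} (hf : PolyTime f) (hg : PolyTime g) :
    PolyTime fun a => Nat.beq (f a) (g a) :=
  PolyTime.congr' (f := fun a => Nat.ble (f a) (g a) && Nat.ble (g a) (f a)) (by fun_prop)
    fun a => by
      rw [Bool.eq_iff_iff, Bool.and_eq_true, Nat.ble_eq, Nat.ble_eq, Nat.beq_eq]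
      omega

@[fun_prop]
theorem min {f g : α → ℕ} (hf : PolyTime f) (hg : PolyTime g) :
    PolyTime fun a => min (f a) (g a) :=
  PolyTime.congr' (f := fun a => bif Nat.ble (f a) (g a) then f a else g a) (by fun_prop)
    fun a => by
      cases h : Nat.ble (f a) (g a)
      · have := Nat.not_le_of_not_ble_eq_true (by simp [h] : ¬ Nat.ble (f a) (g a) = true)
        simp; omega
      · have := Nat.le_of_ble_eq_true h
        simp; omega

@[fun_prop]
theorem mul {f g : α → ℕ} (hf : PolyTime f) (hg : PolyTime g) : PolyTime fun a => f a * g a := by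
  have hf' := hf.comp (f := fun p : α × ℕ × Bool => p.1) (by fun_prop)
  have := foldl_of_add' (f := fun a n b => n + n + bif b then f a else 0) (i := fun _ => 0)
    (l := fun a => (g a).bits.reverse) Nat.size (fun n => (nat_size_lt n).le) size_nat_le
    (by fun_prop) (.const _) (.add (by fun_prop) (.cond (by fun_prop) hf' (.const _)))
    (G := fun a => size (f a) + 2) (.add hf.polyBounded (.const 2)) fun a b _ n => by
      have h₁ : (n + n).size ≤ n.size + 1 := by
        rw [Nat.size_le, pow_succ]
        have := n.lt_size_self
        omega
      have h₂ := nat_size_add_le (n + n) (bif b then f a else 0)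
      have h₃ := Nat.size_le_size (show (bif b then f a else 0) ≤ f a by cases b <;> simp)
      have h₄ := nat_size_lt (f a)
      omega
  refine this.congr' fun a => ?_
  rw [List.foldl_reverse]
  have : ∀ l : List Bool, l.foldr (fun b n => n + n + bif b then f a else 0) 0 =
      f a * StackProgram.ofDigits l := by
    intro l
    induction l with
    | nil => simp
    | cons b l ih => cases b <;> simp [ih] <;> ring
  rw [this, ofDigits_bits]

theorem sum_aux : PolyTime fun l : List ℕ => l.sum := by
  have := foldl_of_add' (α := List ℕ) (f := fun _ n b => b + n) (i := fun _ => 0)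
    (l := fun l => l.reverse) Nat.size (fun n => (nat_size_lt n).le) size_nat_le (by fun_prop)
    (.const _) (by fun_prop) (G := fun l => size l + 1) (.add .id (.const 1)) fun l c hc n => by
      have := nat_size_add_le c n
      have := nat_size_lt c
      have := size_le_of_mem (List.mem_reverse.1 hc)
      omega
  exact this.congr' fun l => by simp [List.foldl_reverse, List.sum]

@[fun_prop]
theorem sum {l : α → List ℕ} (hl : PolyTime l) : PolyTime fun a => (l a).sum := sum_aux.comp hl

theorem prod_aux : PolyTime fun l : List ℕ => l.prod := by
  have := foldl_of_add' (α := List ℕ) (f := fun _ n b => b * n) (i := fun _ => 1)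
    (l := fun l => l.reverse) Nat.size (fun n => (nat_size_lt n).le) size_nat_le (by fun_prop)
    (.const _) (by fun_prop) (G := fun l => size l) .id fun l c hc n => by
      have := nat_size_mul_le c n
      have := nat_size_lt c
      have := size_le_of_mem (List.mem_reverse.1 hc)
      omega
  exact this.congr' fun l => by simp [List.foldl_reverse, List.prod]

@[fun_prop]
theorem prod {l : α → List ℕ} (hl : PolyTime l) : PolyTime fun a => (l a).prod := prod_aux.comp hl

@[fun_prop]
theorem length {l : α → List γ} (hl : PolyTime l) : PolyTime fun a => (l a).length :=
  (sum (map (f := fun _ _ => 1) hl (.const 1))).congr' fun a => by simp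

theorem size_nat_le_of_le_length {n : ℕ} {l : List γ} (h : n ≤ l.length) :
    size n ≤ 4 * size l + 1 := by
  have := size_nat_le n
  have : n.size ≤ n := by rw [Nat.size_le]; exact n.lt_two_pow_self
  have := length_lt_size l
  omega

/-- The length is given by a list, which is at least that large itself; for a number in binary the
range could be exponentially long. -/
theorem range_aux : PolyTime fun l : List γ => List.range l.length := by
  have e : ∀ (l : List γ) (o : List ℕ), l.foldl (fun (o : List ℕ) _ => o ++ [o.length]) o =
      o ++ List.range' o.length l.length := by
    intro l
    induction l with
    | nil => simp
    | cons c l ih => intro o; simp [ih, List.range'_succ]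
  have := foldl (α := List γ) (f := fun _ (o : List ℕ) _ => o ++ [o.length]) (i := fun _ => [])
    .id (.const _) (by fun_prop) (B := fun l => size l * (4 * size l + 2) + 1)
    (.add (.mul .id (.add (.mul (.const 4) .id) (.const 2))) (.const 1)) fun l l' h => by
      rw [e]
      refine (size_list_le _ (4 * size l + 1) fun n hn => ?_).trans ?_
      · simp only [List.length_nil, List.nil_append, List.mem_range'_1] at hn
        exact size_nat_le_of_le_length (by have := h.length_le; omega)
      · have := h.length_le
        have := length_lt_size l
        simp only [List.length_nil, List.nil_append, List.length_range']
        gcongr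
        omega
  exact this.congr' fun l => by rw [e]; simp [List.range_eq_range']

@[fun_prop]
theorem range {l : α → List γ} (hl : PolyTime l) : PolyTime fun a => List.range (l a).length :=
  range_aux.comp hl

@[fun_prop]
theorem getD {l : α → List γ} {i : α → ℕ} {d : α → γ} (hl : PolyTime l) (hi : PolyTime i)
    (hd : PolyTime d) : PolyTime fun a => (l a).getD (i a) (d a) := by
  -- The invariant of a scan that counts positions, starting from `n`, and keeps the entry at
  -- position `i a`.
  have e : ∀ (a : α) (L : List γ) (n : ℕ) (x : γ),
      (L.foldl (fun (s : ℕ × γ) c => (s.1 + 1, bif Nat.beq s.1 (i a) then c else s.2)) (n, x)) =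
        (n + L.length, if n ≤ i a then L.getD (i a - n) x else x) := by
    intro a L
    induction L with
    | nil => simp
    | cons c L ih =>
      intro n x
      simp only [List.foldl_cons, ih, List.length_cons]
      rcases lt_trichotomy n (i a) with h | h | h
      · have h₁ : Nat.beq n (i a) = false := by
          rw [Bool.eq_false_iff, Ne, Nat.beq_eq]; omega
        obtain ⟨k, hk⟩ : ∃ k, i a - n = k + 1 := ⟨i a - n - 1, by omega⟩
        have h₃ : i a - (n + 1) = k := by omega
        rw [if_pos (by omega), if_pos h.le, h₁, hk, h₃]
        simp; omega
      · subst h; simp; omega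
      · have h₁ : Nat.beq n (i a) = false := by
          rw [Bool.eq_false_iff, Ne, Nat.beq_eq]; omega
        rw [if_neg (by omega), if_neg (by omega), h₁]
        simp; omega
  have hi' := hi.comp (f := fun p : α × (ℕ × γ) × γ => p.1) (by fun_prop)
  have := foldl (f := fun a (s : ℕ × γ) c => (s.1 + 1, bif Nat.beq s.1 (i a) then c else s.2))
    (i := fun a => (0, d a)) hl (by fun_prop)
    (.prodMk (by fun_prop) (.cond (.beq (by fun_prop) hi') (by fun_prop) (by fun_prop)))
    (B := fun a => 5 * size (l a) + size (d a) + 2)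
    (.add (.add (.mul (.const 5) hl.polyBounded) hd.polyBounded) (.const 2)) fun a l' h => by
      rw [e]
      have h₁ : size (l'.getD (i a) (d a)) ≤ size (l a) + size (d a) := by
        rcases lt_or_ge (i a) l'.length with h' | h'
        · rw [List.getD_eq_getElem _ _ h']
          exact (size_le_of_mem (h.subset (List.getElem_mem h'))).trans (by omega)
        · rw [List.getD_eq_default _ _ h']
          omega
      have h₂ := size_nat_le_of_le_length h.length_le
      simp only [Nat.zero_add, Nat.zero_le, if_true, Nat.sub_zero, size_pair]
      omega
  exact (PolyTime.snd this).congr' fun a => by rw [e]; simp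

end PolyTime

end StackProgram

namespace DeliveryMarket

open StackProgram

/-! ### The decision procedure -/

/-- The constraint `y i + a ≤ y j + y k + b` on natural or real numbers `y 0, y 1, …`, as the
quintuple `(i, a, j, k, b)`. -/
abbrev Constraint := ℕ × ℕ × ℕ × ℕ × ℕ

/-- Decrease the number on the left-hand side of a constraint so that the constraint holds, unless
it is infeasible. -/
def relax (y : List ℕ) (q : Constraint) : List ℕ :=
  (List.range y.length).map fun h => bif Nat.beq h q.1 then
    min (y.getD h 0) (y.getD q.2.2.1 0 + y.getD q.2.2.2.1 0 + q.2.2.2.2 - q.2.1) else y.getD h 0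

/-- Relax all constraints in turn, as many times as there are variables. -/
def solve (L : List Constraint) (y : List ℕ) : List ℕ :=
  -- In the first factor `y` serves only as a counter: one copy of `L` for each variable.
  (y.flatMap fun _ => L).foldl relax y

/-- Check the constraints. -/
def check (L : List Constraint) (y : List ℕ) : Bool :=
  L.all fun q =>
    Nat.ble (y.getD q.1 0 + q.2.1) (y.getD q.2.2.1 0 + y.getD q.2.2.2.1 0 + q.2.2.2.2)

section

variable (m n l : ℕ) (v : ℕ → ℕ → ℕ) (c : ℕ → ℕ → ℕ → ℕ) (x : ℕ → ℕ → ℕ → Bool)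

/-- The constraints that are due to the delivery of the order `(b, s)` by the courier `d`.
The variables `0, …, l - 1` are the utilities of the couriers, `l, …, l + n - 1` are the prices, and
the variable `l + n` is zero. -/
def orderConstraints (b s d : ℕ) : List Constraint :=
  ((List.range l).map fun d' => (d, c b s d, d', l + n, c b s d')) ++
  (((List.range n).flatMap fun s' => (List.range l).map fun d' =>
    (l + s, v b s', l + s', d', c b s' d' + v b s)) ++
  [(l + s, 0, l + n, l + n, v b s)])

/-- The constraints that are due to a buyer who does not buy. -/
def buyerConstraints (b : ℕ) : List Constraint :=
  (List.range n).flatMap fun s => (List.range l).map fun d => (l + n, v b s, l + s, d, c b s d)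

/-- The constraints that characterize the allocations of equilibria. -/
def constraints : List Constraint :=
  ((List.range m).flatMap fun b => (List.range n).flatMap fun s => (List.range l).flatMap fun d =>
    bif x b s d then orderConstraints n l v c b s d else []) ++
  (((List.range m).flatMap fun b =>
    bif (List.range n).all fun s => (List.range l).all fun d => !x b s d then
      buyerConstraints n l v c b else []) ++
  (((List.range n).flatMap fun s =>
    bif (List.range m).all fun b => (List.range l).all fun d => !x b s d then
      [(l + s, 0, l + n, l + n, 0)] else []) ++
  ((List.range l).flatMap fun d =>
    bif (List.range m).all fun b => (List.range n).all fun s => !x b s d then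
      [(d, 0, l + n, l + n, 0)] else [])))

/-- A bound for all variables. -/
def bound : ℕ :=
  ((List.range m).map fun b => ((List.range n).map fun s => v b s).sum).sum +
  ((List.range m).map fun b =>
    ((List.range n).map fun s => ((List.range l).map fun d => c b s d).sum).sum).sum

/-- The initial values of the variables. -/
def initial (M : ℕ) : List ℕ :=
  ((List.range l).map fun _ => M) ++ (((List.range n).map fun _ => M) ++ [0])

/-- The feasibility of an allocation. -/
def isFeasible : Bool :=
  ((List.range m).all fun b => Nat.ble
    ((List.range n).map fun s => ((List.range l).map fun d => bif x b s d then 1 else 0).sum).sum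
    1) &&
  (((List.range n).all fun s => Nat.ble
    ((List.range m).map fun b => ((List.range l).map fun d => bif x b s d then 1 else 0).sum).sum
    1) &&
  ((List.range l).all fun d => Nat.ble
    ((List.range m).map fun b => ((List.range n).map fun s => bif x b s d then 1 else 0).sum).sum
    1))

/-- The decision procedure for integral valuations and costs. -/
def decideIntegral : Bool :=
  isFeasible m n l x &&
    check (constraints m n l v c x) (solve (constraints m n l v c x) (initial n l (bound m n l v c)))

end

/-- The fields of a word in reverse order; `(true, b)` is the bit `b` and `(false, _)` is the
separator. -/
def fields (w : List (Bool × Bool)) : List (List Bool) :=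
  let p := w.foldl (fun (s : List Bool × List (List Bool)) g =>
    bif g.1 then (g.2 :: s.1, s.2) else ([], s.1 :: s.2)) ([], [])
  p.1 :: p.2

section

variable (E : List (List Bool))

/-- The numerator of the `i`-th rational number. -/
def numerator (i : ℕ) : ℕ := ofDigits (E.getD (3 + 2 * i) [])

/-- The denominator of the `i`-th rational number. -/
def denominator (i : ℕ) : ℕ := ofDigits (E.getD (4 + 2 * i) [true])

/-- The `i`-th rational number times the product of all denominators. -/
def scaled (i : ℕ) : ℕ :=
  -- Leaving out the factor with index `i` avoids a division.
  numerator E i *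
    ((List.range E.length).map fun j => bif Nat.beq j i then 1 else denominator E j).prod

/-- The number of buyers. -/
def numBuyers : ℕ := (E.getD 0 []).length

/-- The number of stores. -/
def numStores : ℕ := (E.getD 1 []).length

/-- The number of couriers. -/
def numCouriers : ℕ := (E.getD 2 []).length

/-- The scaled valuations. -/
def scaledValue (b s : ℕ) : ℕ := scaled E (b * numStores E + s)

/-- The scaled costs. -/
def scaledCost (b s d : ℕ) : ℕ :=
  scaled E (numBuyers E * numStores E + ((b * numStores E + s) * numCouriers E + d))

/-- The allocation. -/
def allocated (b s d : ℕ) : Bool :=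
  -- The table ends the word without a separator, so it is the last field.
  (E.getD (E.length - 1) []).getD ((b * numStores E + s) * numCouriers E + d) false

/-- The decision procedure on the fields of the input. -/
def decideFields : Bool :=
  decideIntegral (numBuyers E) (numStores E) (numCouriers E) (scaledValue E) (scaledCost E)
    (allocated E)

end

end DeliveryMarket

/-! ### The decision procedure runs in polynomial time -/

namespace StackProgram.PolyTime

open DeliveryMarket

variable {α : Type} [Data α] {E : α → List (List Bool)} {i b s d : α → ℕ}

attribute [fun_prop] PolyTime.map PolyTime.flatMap PolyTime.all

theorem fields : PolyTime fun w => fields w := by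
  have := foldl_of_add (α := List (Bool × Bool)) (f := fun _ (s : List Bool × List (List Bool)) g =>
    bif g.1 then (g.2 :: s.1, s.2) else ([], s.1 :: s.2)) (i := fun _ => ([], []))
    (l := fun w => w) .id (.const _) (by fun_prop) (G := fun _ => 10) (.const _) fun w g _ s => by
      have := size_bool_le g.2
      cases g.1 <;> simp <;> omega
  unfold DeliveryMarket.fields
  fun_prop

@[fun_prop]
theorem scaled (hE : PolyTime E) (hi : PolyTime i) : PolyTime fun a => scaled (E a) (i a) := by
  unfold DeliveryMarket.scaled numerator denominator
  fun_prop

@[fun_prop]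
theorem scaledValue (hE : PolyTime E) (hb : PolyTime b) (hs : PolyTime s) :
    PolyTime fun a => scaledValue (E a) (b a) (s a) := by
  unfold DeliveryMarket.scaledValue numStores
  fun_prop

@[fun_prop]
theorem scaledCost (hE : PolyTime E) (hb : PolyTime b) (hs : PolyTime s) (hd : PolyTime d) :
    PolyTime fun a => scaledCost (E a) (b a) (s a) (d a) := by
  unfold DeliveryMarket.scaledCost numStores numBuyers numCouriers
  fun_prop

@[fun_prop]
theorem allocated (hE : PolyTime E) (hb : PolyTime b) (hs : PolyTime s) (hd : PolyTime d) :
    PolyTime fun a => allocated (E a) (b a) (s a) (d a) := by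
  unfold DeliveryMarket.allocated numStores numCouriers
  fun_prop

/-- The numbers of agents are unfolded to lengths of unary fields, so that every range is the range
of the length of a list. -/
theorem constraints : PolyTime fun E => constraints (numBuyers E) (numStores E) (numCouriers E)
    (DeliveryMarket.scaledValue E) (DeliveryMarket.scaledCost E)
    (DeliveryMarket.allocated E) := by
  unfold DeliveryMarket.constraints orderConstraints buyerConstraints numBuyers numStores
    numCouriers
  fun_prop

theorem initial : PolyTime fun E => initial (numStores E) (numCouriers E) (bound (numBuyers E)
    (numStores E) (numCouriers E) (DeliveryMarket.scaledValue E)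
    (DeliveryMarket.scaledCost E)) := by
  unfold DeliveryMarket.initial bound numBuyers numStores numCouriers
  fun_prop

theorem isFeasible : PolyTime fun E => isFeasible (numBuyers E) (numStores E) (numCouriers E)
    (DeliveryMarket.allocated E) := by
  unfold DeliveryMarket.isFeasible numBuyers numStores numCouriers
  fun_prop

theorem length_relax (y : List ℕ) (q : Constraint) : (relax y q).length = y.length := by
  simp [relax]

theorem relax_le_sum {M : ℕ} {y : List ℕ} (hy : ∀ n ∈ y, n ≤ M) (q : Constraint) :
    ∀ n ∈ relax y q, n ≤ M := by
  intro n hn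
  simp only [relax, List.mem_map, List.mem_range] at hn
  obtain ⟨h, hh, rfl⟩ := hn
  have : y.getD h 0 ≤ M := by
    rw [List.getD_eq_getElem _ _ hh]
    exact hy _ (List.getElem_mem hh)
  cases Nat.beq h q.1 <;> simp only [cond_true, cond_false] <;> omega

@[fun_prop]
theorem solve {L : α → List Constraint} {y : α → List ℕ} (hL : PolyTime L) (hy : PolyTime y) :
    PolyTime fun a => solve (L a) (y a) := by
  have key : ∀ (M : ℕ) (Q : List Constraint) (z : List ℕ), (∀ n ∈ z, n ≤ M) →
      (Q.foldl relax z).length = z.length ∧ ∀ n ∈ Q.foldl relax z, n ≤ M := by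
    intro M Q
    induction Q with
    | nil => simp
    | cons q Q ih =>
      intro z hz
      have := ih (relax z q) (relax_le_sum hz q)
      rwa [length_relax] at this
  -- Relaxing never raises a value, so in all rounds every entry is at most the sum of the initial
  -- ones.
  refine foldl (f := fun _ z q => relax z q) (by fun_prop) hy (by unfold relax; fun_prop)
    (B := fun a => size (y a) * (4 * size (y a).sum + 1) + 1)
    (.add (.mul hy.polyBounded (.add (.mul (.const 4) (sum hy).polyBounded) (.const 1)))
      (.const 1)) fun a Q _ => ?_
  obtain ⟨h₁, h₂⟩ := key (y a).sum Q (y a) fun n hn => List.single_le_sum (by simp) n hn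
  refine (size_list_le _ (4 * size (y a).sum) fun n hn => size_nat_mono (h₂ n hn)).trans ?_
  have := length_lt_size (y a)
  rw [h₁]
  gcongr

@[fun_prop]
theorem check {L : α → List Constraint} {y : α → List ℕ} (hL : PolyTime L) (hy : PolyTime y) :
    PolyTime fun a => check (L a) (y a) := by
  unfold DeliveryMarket.check
  fun_prop

theorem decideFields : PolyTime fun E => decideFields E := by
  have h₁ := constraints
  have h₂ := initial
  have h₃ := isFeasible
  unfold DeliveryMarket.decideFields decideIntegral
  fun_prop

end StackProgram.PolyTime

namespace StackProgram

open Prog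

/-! ### Input and output -/

/-- A symbol as a pair: `(true, b)` for the bit `b`, and `(false, false)` for all others. -/
def symbol : Γ' → Bool × Bool
  | .bit b => (true, b)
  | _ => (false, false)

theorem word_cons {α : Type} [Data α] (a : α) (l : List α) :
    word (a :: l) = .bit true :: (word a ++ word l) := rfl

/-- Read the input and push the list of its symbols, in reverse order, on the stack of values. -/
abbrev Prog.load : Prog :=
  .loop .inp Option.isSome fun o => pushAll .main (.bit true :: word (symbol (o.getD default)))

theorem runs_load (i : List Γ') (w : List (Bool × Bool)) :
    Runs load (store i (word w) [] [] []) (vals (word ((i.map symbol).reverse ++ w)))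
      (i.length * 10 + 1) := by
  induction i generalizing w with
  | nil =>
    have h : Runs load (store [] (word w) [] [] []) _ 1 := Runs.exit rfl
    rw [update_inp] at h
    exact h
  | cons g i ih =>
    have h := runs_pushAll .main (.bit true :: word (symbol g)) (store i (word w) [] [] [])
    have ih := ih (symbol g :: w)
    have hs : (word (symbol g)).length ≤ 7 := by
      rcases g with - | b | - | - | - <;> try decide
      cases b <;> decide
    have ih' : Runs load (store i (.bit true :: (word (symbol g) ++ word w)) [] [] [])
        (vals (word (((g :: i).map symbol).reverse ++ w))) (i.length * 10 + 1) := by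
      simpa [word_cons] using ih
    refine (Runs.loop (k := .inp) rfl (by simpa using h) ih').mono ?_
    simp only [List.length_cons]
    omega

/-- Replace a Boolean value by a single symbol. -/
abbrev Prog.answer : Prog :=
  .pop .main fun o => if o = some (.bit true) then
    .pop .main fun _ => .pop .main fun _ => .push .main (.bit true) else .push .main (.bit false)

theorem runs_answer (b : Bool) : Runs answer (vals (word b)) (vals [.bit b]) 4 := by
  cases b
  · have := Runs.push .main (.bit false) (vals [])
    exact (Runs.pop (by simpa [word, Data.tree, BTree.flat] using this)).mono (by omega)
  · have := Runs.push .main (.bit true) (vals [])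
    have := Runs.pop (S := vals [.bit false]) (k := .main) (f := fun _ => .push .main (.bit true))
      (by simpa using this)
    have := Runs.pop (S := vals [.bit false, .bit false]) (k := .main)
      (f := fun _ => .pop .main fun _ => .push .main (.bit true)) (by simpa using this)
    exact Runs.pop (by simpa [word, Data.tree, BTree.flat] using this)

/-- A function on the reversed list of symbols that is computable in polynomial time decides a
property in polynomial time. -/
theorem PolyTime.decidableInPolyTime {f : List (Bool × Bool) → Bool} (hf : PolyTime f) {α : Type}
    (enc : α → List Γ') (P : α → Prop)
    (h : ∀ a, f ((enc a).map symbol).reverse = true ↔ P a) :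
    DeliveryMarket.DecidableInPolyTime enc P := by
  obtain ⟨p, B, ⟨q, hq⟩, hp⟩ := hf
  -- Loading costs ten steps per symbol; the 6 covers the push of the empty list, the end of the
  -- loading loop and the answer. A symbol becomes a pair of size at most 7, so the loaded list has
  -- size at most `8 * length + 1`.
  refine decidableInPolyTime_of_run enc P (fun a => f ((enc a).map symbol).reverse) h
    (.seq (.push .main (.bit false)) (.seq load (.seq p answer)))
    (.X * 10 + 6 + q.comp (.X * 8 + 1)) fun a => ?_
  have hs : size ((enc a).map symbol).reverse ≤ (enc a).length * 8 + 1 := by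
    refine (size_list_le _ 7 fun g _ => ?_).trans (by simp)
    have := size_bool_le g.1
    have := size_bool_le g.2
    simp only [size_pair]
    omega
  have hq' : B ((enc a).map symbol).reverse ≤ _ := (hq _).trans (eval_mono q hs)
  have h₀ := Runs.push .main (.bit false) (store (enc a) [] [] [] [])
  have h₁ := runs_load (enc a) []
  have h₂ := (hp ((enc a).map symbol).reverse).2 []
  rw [List.append_nil] at h₁ h₂
  rw [List.append_nil] at h₂
  rw [update_main] at h₀
  obtain ⟨t, ht, hr⟩ := h₀.seq (h₁.seq (h₂.seq (runs_answer _)))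
  refine ⟨t, ht.trans ?_, by rw [values_eq_store, values_eq_store]; exact hr⟩
  simp at hq' ⊢
  omega

end StackProgram

namespace DeliveryMarket

/-! ### Correctness of the relaxation -/

/-- The constraint holds for the real numbers `y`. -/
def Constraint.Holds (q : Constraint) (y : ℕ → ℝ) : Prop :=
  y q.1 + q.2.1 ≤ y q.2.2.1 + y q.2.2.2.1 + q.2.2.2.2

/-- `relax` for sequences. -/
def relaxFun (z : ℕ → ℕ) (q : Constraint) : ℕ → ℕ :=
  Function.update z q.1 (min (z q.1) (z q.2.2.1 + z q.2.2.2.1 + q.2.2.2.2 - q.2.1))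

theorem relaxFun_le (z : ℕ → ℕ) (q : Constraint) : relaxFun z q ≤ z := by
  intro i
  by_cases h : i = q.1
  · subst h; simp [relaxFun]
  · simp [relaxFun, h]

theorem foldl_relaxFun_le (L : List Constraint) (z : ℕ → ℕ) : L.foldl relaxFun z ≤ z := by
  induction L generalizing z with
  | nil => exact le_rfl
  | cons q L ih => exact (ih _).trans (relaxFun_le z q)

theorem foldl_relaxFun_of_notMem (L : List Constraint) (z : ℕ → ℕ) (i : ℕ)
    (h : ∀ q ∈ L, q.1 ≠ i) : L.foldl relaxFun z i = z i := by
  induction L generalizing z with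
  | nil => rfl
  | cons q L ih =>
    rw [List.foldl_cons, ih _ fun q' hq' => h q' (List.mem_cons_of_mem _ hq')]
    simp [relaxFun, (h q List.mem_cons_self).symm]

/-- The right-hand sides are monotone, so an upper bound of a solution stays one after lowering;
truncating the subtraction at zero only makes the new value larger. -/
theorem le_foldl_relaxFun {L : List Constraint} {y : ℕ → ℝ} (hy : ∀ q ∈ L, q.Holds y)
    (z : ℕ → ℕ) (hz : ∀ i, y i ≤ z i) (i : ℕ) : y i ≤ L.foldl relaxFun z i := by
  induction L generalizing z with
  | nil => exact hz i
  | cons q L ih =>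
    refine ih (fun q' hq' => hy q' (List.mem_cons_of_mem _ hq')) _ fun i => ?_
    by_cases h : i = q.1
    · subst h
      have h₁ := hy q List.mem_cons_self
      have h₂ := hz q.2.2.1
      have h₃ := hz q.2.2.2.1
      unfold Constraint.Holds at h₁
      simp only [relaxFun, Function.update_self, Nat.cast_min, le_inf_iff]
      refine ⟨hz _, ?_⟩
      have : ((z q.2.2.1 + z q.2.2.2.1 + q.2.2.2.2 : ℕ) : ℝ) ≤
          ((z q.2.2.1 + z q.2.2.2.1 + q.2.2.2.2 - q.2.1 : ℕ) : ℝ) + (q.2.1 : ℕ) := by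
        exact_mod_cast (by omega)
      push_cast at this
      linarith
    · simpa [relaxFun, h] using hz i

/-- Both right-hand variables start the round at their values in `g` and cannot fall below them, so
they still have these values when `q` has its turn; afterwards the left-hand variable only
decreases. -/
theorem foldl_relaxFun_apply_le {L : List Constraint} {q : Constraint} (hq : q ∈ L) {z g : ℕ → ℕ}
    (hg : g ≤ L.foldl relaxFun z) (h₁ : z q.2.2.1 = g q.2.2.1) (h₂ : z q.2.2.2.1 = g q.2.2.2.1) :
    L.foldl relaxFun z q.1 ≤ g q.2.2.1 + g q.2.2.2.1 + q.2.2.2.2 - q.2.1 := by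
  induction L generalizing z with
  | nil => simp at hq
  | cons p L ih =>
    rw [List.foldl_cons] at hg ⊢
    rcases List.mem_cons.1 hq with rfl | hq
    · refine (foldl_relaxFun_le L _ _).trans ?_
      rw [← h₁, ← h₂]
      simp [relaxFun]
    · have h := hg.trans (foldl_relaxFun_le L _)
      have h' := relaxFun_le z p
      exact ih hq hg (((h' _).trans h₁.le).antisymm (h _)) (((h' _).trans h₂.le).antisymm (h _))

/-- If the constraints have a solution below `z`, then relaxing them as many times as there are
variables yields a solution. -/
theorem holds_iterate_relaxFun (L : List Constraint) (N : ℕ) (hL : ∀ q ∈ L, q.1 < N) (z : ℕ → ℕ)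
    {y : ℕ → ℝ} (hy : ∀ q ∈ L, q.Holds y) (hy₀ : ∀ i, 0 ≤ y i) (hz : ∀ i, y i ≤ z i)
    {q : Constraint} (hq : q ∈ L) : q.Holds fun i => ((L.foldl relaxFun)^[N] z i : ℝ) := by
  set T : (ℕ → ℕ) → ℕ → ℕ := L.foldl relaxFun with hT
  have hs : ∀ r, T^[r + 1] z = T (T^[r] z) := fun r => Function.iterate_succ_apply' T r z
  have anti : Antitone fun r => T^[r] z := antitone_nat_of_succ_le fun r => by
    rw [hs]; exact foldl_relaxFun_le L _
  have out : ∀ r i, N ≤ i → T^[r] z i = z i := by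
    intro r i hi
    induction r with
    | zero => rfl
    | succ r ih =>
      rw [hs, ← ih]
      exact foldl_relaxFun_of_notMem L _ i fun q hq => by have := hL q hq; omega
  have lower : ∀ (x : ℕ → ℝ), (∀ q ∈ L, q.Holds x) → ∀ r k, (∀ i, x i ≤ T^[r] z i) →
      ∀ i, x i ≤ T^[r + k] z i := by
    intro x hx r k h
    induction k with
    | zero => exact h
    | succ k ih =>
      intro i
      rw [← add_assoc, hs]
      exact le_foldl_relaxFun hx _ ih i
  -- A sum of natural numbers attains its minimum over the rounds. The iterates decrease, so from
  -- there on they are constant; `g` is this limit.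
  obtain ⟨r₀, hr₀⟩ : ∃ r₀, ∀ r, ∑ i ∈ Finset.range N, T^[r₀] z i ≤
      ∑ i ∈ Finset.range N, T^[r] z i :=
    ⟨_, fun r => Function.argmin_le (fun r => ∑ i ∈ Finset.range N, T^[r] z i) r⟩
  set g := T^[r₀] z with hg
  have stable : ∀ r, r₀ ≤ r → T^[r] z = g := by
    intro r hr
    funext i
    by_cases hi : i < N
    · have h := (Finset.sum_eq_sum_iff_of_le fun i _ => anti hr i).1
        (le_antisymm (Finset.sum_le_sum fun i _ => anti hr i) (hr₀ r))
      exact h i (Finset.mem_range.2 hi)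
    · rw [out r i (by omega), hg, out r₀ i (by omega)]
  have below : ∀ r, g ≤ T^[r] z := by
    intro r
    rcases le_total r r₀ with h | h
    · exact anti h
    · exact (stable r h).ge
  have hyg : ∀ i, y i ≤ g i := by
    have := lower y hy 0 r₀ hz
    simpa using this
  have fixed : ∀ q ∈ L, g q.1 + q.2.1 ≤ g q.2.2.1 + g q.2.2.2.1 + q.2.2.2.2 := by
    intro q hq
    have e : T g = g := by rw [hg, ← hs, stable _ (Nat.le_succ _)]
    have h₁ := foldl_relaxFun_apply_le hq (z := g) (g := g) e.ge rfl rfl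
    change T g q.1 ≤ _ at h₁
    rw [e] at h₁
    -- The nonnegative real solution lies below `g`, so the subtraction is not truncated at `g`.
    have h₂ : q.2.1 ≤ g q.2.2.1 + g q.2.2.2.1 + q.2.2.2.2 := by
      have h := hy q hq
      unfold Constraint.Holds at h
      have := hyg q.2.2.1
      have := hyg q.2.2.2.1
      have := hy₀ q.1
      have : (q.2.1 : ℝ) ≤ g q.2.2.1 + g q.2.2.2.1 + q.2.2.2.2 := by linarith
      exact_mod_cast this
    omega
  -- The variables that have not reached their limit after `r` rounds. This set loses an element in
  -- each round until it is empty.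
  let F : ℕ → Finset ℕ := fun r => (Finset.range N).filter fun i => T^[r] z i ≠ g i
  have hF : ∀ r i, T^[r] z i ≠ g i ↔ i ∈ F r := by
    intro r i
    simp only [F, Finset.mem_filter, Finset.mem_range, ne_eq, iff_and_self]
    intro h
    by_contra hi
    exact h (by rw [out r i (by omega), hg, out r₀ i (by omega)])
  have sub : ∀ r, F (r + 1) ⊆ F r := by
    intro r i hi
    rw [← hF] at hi ⊢
    have h₁ : g i ≤ T^[r + 1] z i := below (r + 1) i
    have h₂ : T^[r + 1] z i ≤ T^[r] z i := anti (Nat.le_succ r) i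
    omega
  have strict : ∀ r, (F r).Nonempty → F (r + 1) ≠ F r := by
    intro r ⟨i, hi⟩ heq
    -- If a round removes nothing from `F r`, then `g` raised by one on `F r` is again a solution. A
    -- raised left-hand side is matched by a raised variable on the right, or both right-hand
    -- variables are already final; then the value after the round obeys the constraint and still
    -- exceeds `g`, which leaves slack at least one.
    have key : ∀ q ∈ L, q.Holds fun i => ((g i + if i ∈ F r then 1 else 0 : ℕ) : ℝ) := by
      intro q hq
      have h := fixed q hq
      unfold Constraint.Holds
      beta_reduce
      norm_cast
      by_cases h₁ : q.1 ∈ F r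
      · by_cases h₂ : q.2.2.1 ∈ F r
        · rw [if_pos h₁, if_pos h₂]; omega
        · by_cases h₃ : q.2.2.2.1 ∈ F r
          · rw [if_pos h₁, if_pos h₃]; omega
          · rw [if_pos h₁, if_neg h₂, if_neg h₃]
            have h₄ := foldl_relaxFun_apply_le hq (z := T^[r] z) (g := g)
              ((below (r + 1)).trans (hs r).le) (not_not.1 ((hF r _).not.2 h₂))
              (not_not.1 ((hF r _).not.2 h₃))
            change T (T^[r] z) q.1 ≤ _ at h₄
            rw [← hs] at h₄
            have h₅ := (hF (r + 1) q.1).2 (heq ▸ h₁)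
            have h₆ : g q.1 ≤ T^[r + 1] z q.1 := below (r + 1) q.1
            omega
      · rw [if_neg h₁]; omega
    -- This solution lies below the current iterate, hence below all later ones and below their
    -- limit `g`, which fails at `i`.
    have h := lower _ key r r₀ (fun i => by
      have h₁ : g i ≤ T^[r] z i := below r i
      have h₂ := hF r i
      norm_cast
      split_ifs with h₃
      · have := h₂.2 h₃
        omega
      · exact h₁) i
    rw [stable _ (Nat.le_add_left _ _), if_pos hi] at h
    norm_cast at h
    omega
  have card : ∀ r, (F r).card ≤ N - r := by
    intro r
    induction r with
    | zero => simpa [F] using (Finset.card_filter_le (Finset.range N) _)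
    | succ r ih =>
      rcases (F r).eq_empty_or_nonempty with h | h
      · have := sub r
        rw [h, Finset.subset_empty] at this
        simp [this]
      · have := Finset.card_lt_card ((sub r).ssubset_of_ne (strict r h))
        omega
  have hfin : T^[N] z = g := by
    have h : F N = ∅ := by
      have := card N
      rw [Nat.sub_self, Nat.le_zero, Finset.card_eq_zero] at this
      exact this
    funext i
    by_contra hi
    have := (hF N i).1 hi
    simp [h] at this
  rw [hfin]
  unfold Constraint.Holds
  beta_reduce
  exact_mod_cast fixed q hq

theorem getD_relax {z : List ℕ} {q : Constraint} (hq : q.1 < z.length) :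
    (fun i => (relax z q).getD i 0) = relaxFun (fun i => z.getD i 0) q := by
  funext i
  by_cases hi : i < z.length
  · rw [List.getD_eq_getElem _ _ (by simpa [relax] using hi)]
    by_cases h : i = q.1
    · simp [relax, relaxFun, h]
    · have : Nat.beq i q.1 = false := by rw [Bool.eq_false_iff, Ne, Nat.beq_eq]; exact h
      simp [relax, relaxFun, this, Function.update_of_ne h]
  · rw [List.getD_eq_default _ _ (by simpa [relax] using hi)]
    rw [relaxFun, Function.update_of_ne (by omega), List.getD_eq_default _ _ (by omega)]

theorem getD_foldl_relax (L : List Constraint) {z : List ℕ} (hL : ∀ q ∈ L, q.1 < z.length) :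
    (L.foldl relax z).length = z.length ∧
    (fun i => (L.foldl relax z).getD i 0) = L.foldl relaxFun fun i => z.getD i 0 := by
  induction L generalizing z with
  | nil => simp
  | cons q L ih =>
    have hl : (relax z q).length = z.length := by simp [relax]
    have := ih (z := relax z q) fun q' hq' => hl.symm ▸ hL q' (List.mem_cons_of_mem _ hq')
    rw [hl, getD_relax (hL q List.mem_cons_self)] at this
    exact this

theorem foldl_flatMap_const {α β γ : Type*} (C : List γ) (L : List α) (f : β → α → β) (z : β) :
    (C.flatMap fun _ => L).foldl f z = (L.foldl f)^[C.length] z := by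
  induction C generalizing z with
  | nil => rfl
  | cons c C ih => simp [ih]

/-- The relaxation decides whether the constraints have a solution. -/
theorem check_solve_iff (L : List Constraint) (z : List ℕ) (hL : ∀ q ∈ L, q.1 < z.length) :
    check L (solve L z) = true ↔ ∃ y : ℕ → ℝ, (∀ i, 0 ≤ y i) ∧ (∀ i, y i ≤ (z.getD i 0 : ℕ)) ∧
      ∀ q ∈ L, q.Holds y := by
  have h := (getD_foldl_relax (z.flatMap fun _ => L) (z := z) fun q hq => by
    obtain ⟨_, _, hq⟩ := List.mem_flatMap.1 hq
    exact hL q hq).2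
  rw [foldl_flatMap_const (f := relaxFun)] at h
  have hc : check L (solve L z) = true ↔
      ∀ q ∈ L, q.Holds fun i => (((solve L z).getD i 0 : ℕ) : ℝ) := by
    simp only [check, List.all_eq_true, Nat.ble_eq, Constraint.Holds]
    exact forall₂_congr fun q _ => by norm_cast
  have e : ∀ i, (solve L z).getD i 0 = (L.foldl relaxFun)^[z.length] (fun i => z.getD i 0) i :=
    fun i => congrFun h i
  rw [hc]
  constructor
  · intro hs
    refine ⟨_, fun i => Nat.cast_nonneg _, fun i => ?_, hs⟩
    rw [e, Nat.cast_le]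
    have : ∀ r, (L.foldl relaxFun)^[r] (fun i => z.getD i 0) ≤ fun i => z.getD i 0 := by
      intro r
      induction r with
      | zero => exact le_rfl
      | succ r ih =>
        rw [Function.iterate_succ_apply']
        exact (foldl_relaxFun_le L _).trans ih
    exact this _ i
  · rintro ⟨y, h₀, hz, hy⟩ q hq
    simp only [e]
    exact holds_iterate_relaxFun L z.length hL _ hy h₀ hz hq

end DeliveryMarket

namespace DeliveryMarket

/-! ### Equilibria as solutions of linear inequalities -/

section BestResponses

variable {α R : Type*} [LinearOrder R] [Zero R] {u : α → R}

/-- The two cases of the definition merge: a maximizer with nonnegative utility is either positive,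
which is the first case, or zero, and then no option is positive. -/
theorem some_mem_bestResponses {a : α} :
    some a ∈ bestResponses u ↔ 0 ≤ u a ∧ ∀ a', u a' ≤ u a := by
  constructor
  · rintro (⟨⟨a₀, h₀⟩, a', h, h'⟩ | ⟨h₀, h | ⟨a', h, h'⟩⟩)
    · obtain rfl := Option.some.inj h
      exact ⟨h₀.le.trans (h' a₀), h'⟩
    · simp at h
    · obtain rfl := Option.some.inj h
      exact ⟨h'.ge, fun a₁ => h' ▸ not_lt.1 fun h₁ => h₀ ⟨a₁, h₁⟩⟩
  · rintro ⟨h, h'⟩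
    rcases h.lt_or_eq with h₀ | h₀
    · exact .inl ⟨⟨a, h₀⟩, a, rfl, h'⟩
    · exact .inr ⟨fun ⟨a', ha'⟩ => (ha'.trans_le (h' a')).ne h₀, .inr ⟨a, rfl, h₀.symm⟩⟩

theorem none_mem_bestResponses : none ∈ bestResponses u ↔ ∀ a, u a ≤ 0 := by
  constructor
  · rintro (⟨_, a', h, _⟩ | ⟨h₀, _⟩)
    · simp at h
    · exact fun a => not_lt.1 fun h => h₀ ⟨a, h⟩
  · exact fun h => .inr ⟨fun ⟨a, ha⟩ => (h a).not_gt ha, .inl rfl⟩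

end BestResponses

/-- Two different `true` entries would contribute two to the sum. This gives uniqueness of a buyer's
store and courier and of a courier's order. -/
theorem eq_and_eq_of_sum_le_one {ι κ : Type*} [Fintype ι] [Fintype κ] {f : ι → κ → Bool}
    (hf : ∑ i, ∑ j, (f i j).toNat ≤ 1) {i i' : ι} {j j' : κ} (h : f i j = true)
    (h' : f i' j' = true) : i = i' ∧ j = j' := by
  classical
  by_contra hne
  have hne : (i, j) ≠ (i', j') := fun e => hne ⟨congrArg Prod.fst e, congrArg Prod.snd e⟩
  rw [← Finset.sum_product'] at hf
  have := Finset.sum_le_sum_of_subset (f := fun q : ι × κ => (f q.1 q.2).toNat)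
    (Finset.subset_univ {(i, j), (i', j')})
  rw [Finset.sum_pair hne] at this
  simp only [h, h', Bool.toNat_true, ← Finset.univ_product_univ] at this
  omega

section

variable {B S D : Type*}

/-- Utilities `k` of the couriers and prices `p` that characterize the equilibria with the
allocation `x`. -/
structure IsSolution (v : B → S → ℝ) (c : D → B → S → ℝ) (x : Allocation B S D) (k : D → ℝ)
    (p : S → ℝ) : Prop where
  utility_nonneg : ∀ d, 0 ≤ k d
  price_nonneg : ∀ s, 0 ≤ p s
  courier : ∀ b s d d', x b s d = true → k d + c d b s ≤ k d' + c d' b s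
  buyer : ∀ b s d s' d', x b s d = true → p s + v b s' ≤ p s' + k d' + (c d' b s' + v b s)
  price_le : ∀ b s d, x b s d = true → p s ≤ v b s
  no_store : ∀ b, (∀ s d, x b s d = false) → ∀ s d, v b s ≤ p s + k d + c d b s
  unsold : ∀ s, (∀ b d, x b s d = false) → p s ≤ 0
  idle : ∀ d, (∀ b s, x b s d = false) → k d ≤ 0

namespace Market

variable [DecidableEq B] {M : Market B S D}

theorem minTip_nonneg (w t : B → S → ℝ) (b : B) (s : S) : 0 ≤ M.minTip w t b s := by
  refine le_sInf ?_
  rintro _ ⟨_, ⟨r, hr, rfl, _⟩, rfl⟩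
  exact EReal.coe_nonneg.2 (hr s)

variable [Fintype B] [Fintype S] [Fintype D] {x : Allocation B S D}

/-- The utilities of the couriers and the prices of an equilibrium. -/
theorem IsWithTipEquilibrium.exists_isSolution {p : S → ℝ} {w t : B → S → ℝ}
    (h : M.IsWithTipEquilibrium p w t x) : ∃ k, IsSolution M.value M.cost x k p := by
  classical
  -- The equilibrium utility of courier `d`: that of the delivered order, or zero if `d` is idle.
  have hk : ∀ d, ∃ k : ℝ, 0 ≤ k ∧ (∀ q, M.courierUtility w t d q ≤ k) ∧
      (∀ b s, x b s d = true → k = w b s - M.cost d b s + t b s) ∧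
      ((∀ b s, x b s d = false) → k = 0) := by
    intro d
    by_cases hd : ∃ b s, x b s d = true
    · obtain ⟨b, s, hx⟩ := hd
      have := some_mem_bestResponses.1 (h.courier_favorite d (some (b, s)) hx)
      refine ⟨_, this.1, this.2, fun b' s' hx' => ?_, fun h' => by simp [h'] at hx⟩
      obtain ⟨rfl, rfl⟩ := eq_and_eq_of_sum_le_one (h.feasible.2.2 d) hx hx'
      rfl
    · push Not at hd
      have hd : ∀ b s, x b s d = false := by simpa using hd
      have := none_mem_bestResponses.1 (h.courier_favorite d none hd)
      exact ⟨0, le_rfl, this, fun b s hx => by simp [hd] at hx, fun _ => rfl⟩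
  choose k hk₀ hk₁ hk₂ hk₃ using hk
  -- Tip just enough on `s` to give `d` at least `k d`, and nothing at the other stores. No other
  -- order gives `d` more than `k d`, since withdrawing tips only lowers utilities. The tip is at
  -- most `c + k` because `w` is nonnegative.
  have tip : ∀ b s d, M.minTip w t b s ≤ ((M.cost d b s + k d : ℝ) : EReal) := by
    intro b s d
    have hw := h.compensation_nonneg
    have ht := h.tip_nonneg
    have hc := M.cost_nonneg d b s
    have hkd := hk₀ d
    have hτ := le_max_left 0 (M.cost d b s - w b s + k d)
    have hτ' := le_max_right 0 (M.cost d b s - w b s + k d)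
    have hτ'' : max 0 (M.cost d b s - w b s + k d) ≤ M.cost d b s + k d :=
      max_le (by linarith) (by linarith [hw b s])
    generalize max 0 (M.cost d b s - w b s + k d) = τ at hτ hτ' hτ''
    refine sInf_le_of_le ⟨τ, ⟨Function.update 0 s τ, fun s' => ?_, Function.update_self .., d, ?_⟩,
      rfl⟩ (EReal.coe_le_coe_iff.2 hτ'')
    · by_cases hs : s' = s
      · subst hs; simpa
      · simp [hs]
    · refine some_mem_bestResponses.2 ?_
      have e : M.courierUtility w (Function.update t b (Function.update 0 s τ)) d (b, s) =
          w b s - M.cost d b s + τ := by simp [courierUtility]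
      rw [e]
      refine ⟨by linarith, fun q => ?_⟩
      obtain ⟨b', s'⟩ := q
      have h₁ := hk₁ d (b', s')
      have h₂ := ht b' s'
      by_cases hb : b' = b
      · subst hb
        by_cases hs : s' = s
        · subst hs; exact e.le
        · simp only [courierUtility, Function.update_self, ne_eq, hs, not_false_eq_true,
            Function.update_of_ne, Pi.zero_apply] at *
          linarith
      · simp only [courierUtility, ne_eq, hb, not_false_eq_true, Function.update_of_ne] at *
        linarith
  -- This bound and the next replace the minimum tip by its extremes `c + k` and `0`; comparing them
  -- turns the buyers' conditions into linear inequalities.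
  have util : ∀ b s d, ((M.value b s - p s - (M.cost d b s + k d) : ℝ) : EReal) ≤
      M.buyerUtility p w t b s := fun b s d => by
    rw [EReal.coe_sub, EReal.coe_sub]
    exact EReal.sub_le_sub le_rfl (tip b s d)
  have util' : ∀ b s, M.buyerUtility p w t b s ≤ ((M.value b s - p s : ℝ) : EReal) :=
    fun b s => by
    have := EReal.sub_le_sub (le_refl ((M.value b s : EReal) - (p s : EReal)))
      (minTip_nonneg (M := M) w t b s)
    simpa [buyerUtility] using this
  have fav : ∀ b s d, x b s d = true → 0 ≤ M.buyerUtility p w t b s ∧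
      ∀ s', M.buyerUtility p w t b s' ≤ M.buyerUtility p w t b s := fun b s d hx =>
    some_mem_bestResponses.1 (h.buyer_favorite b (some s) ⟨d, hx⟩)
  refine ⟨k, hk₀, h.price_nonneg, fun b s d d' hx => ?_, fun b s d s' d' hx => ?_,
    fun b s d hx => ?_, fun b hb s d => ?_, fun s hs => (h.unsold_price s hs).le,
    fun d hd => (hk₃ d hd).le⟩
  · have h₁ := hk₂ d b s hx
    have h₂ := hk₁ d' (b, s)
    simp only [courierUtility] at h₂
    linarith
  · have := EReal.coe_le_coe_iff.1 ((util b s' d').trans (((fav b s d hx).2 s').trans (util' b s)))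
    linarith
  · have := EReal.coe_le_coe_iff.1 ((fav b s d hx).1.trans (util' b s))
    linarith
  · have := none_mem_bestResponses.1 (h.buyer_favorite b none hb) s
    have := EReal.coe_le_coe_iff.1 ((util b s d).trans this)
    linarith

/-- A solution yields an equilibrium without tips. -/
theorem isWithTipEquilibrium_of_isSolution {k : D → ℝ} {p : S → ℝ} (hx : x.IsFeasible)
    (h : IsSolution M.value M.cost x k p) : M.SupportsAllocation x := by
  classical
  -- By feasibility the sum has at most one nonzero term: a delivered order pays its courier exactly
  -- cost plus `k d`, and all other orders pay zero.
  let w : B → S → ℝ := fun b s => ∑ d, if x b s d then k d + M.cost d b s else 0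
  have hw : ∀ b s d, x b s d = true → w b s = k d + M.cost d b s := by
    intro b s d hd
    simp only [w]
    rw [Finset.sum_eq_single d (fun d' _ hne => ?_) (by simp), if_pos hd]
    rw [if_neg]
    exact fun hd' => hne (eq_and_eq_of_sum_le_one (hx.1 b) hd hd').2.symm
  have hw₀ : ∀ b s, (∀ d, x b s d = false) → w b s = 0 := fun b s hd => by simp [w, hd]
  have hwn : ∀ b s, 0 ≤ w b s := fun b s => Finset.sum_nonneg fun d _ => by
    have := h.utility_nonneg d
    have := M.cost_nonneg d b s
    split_ifs <;> linarith
  have cases : ∀ b s, (∃ d, x b s d = true) ∨ ∀ d, x b s d = false := fun b s => by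
    by_cases hd : ∃ d, x b s d = true
    · exact .inl hd
    · exact .inr (by simpa using hd)
  have util : ∀ d q, M.courierUtility w 0 d q ≤ k d := by
    rintro d ⟨b, s⟩
    simp only [courierUtility, Pi.zero_apply]
    rcases cases b s with ⟨d', hd'⟩ | hd
    · rw [hw b s d' hd']
      have := h.courier b s d' d hd'
      linarith
    · rw [hw₀ b s hd]
      have := h.utility_nonneg d
      have := M.cost_nonneg d b s
      linarith
  have util' : ∀ d b s, x b s d = true → M.courierUtility w 0 d (b, s) = k d := by
    intro d b s hd
    simp only [courierUtility, Pi.zero_apply, hw b s d hd]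
    ring
  have tip₀ : ∀ b s d, x b s d = true → M.minTip w 0 b s = 0 := by
    intro b s d hd
    refine le_antisymm (sInf_le ⟨0, ⟨0, fun _ => le_rfl, rfl, d, ?_⟩, rfl⟩) (minTip_nonneg ..)
    have e : Function.update (0 : B → S → ℝ) b 0 = 0 := Function.update_eq_self b _
    rw [e]
    exact some_mem_bestResponses.2 (by
      rw [util' d b s hd]
      exact ⟨h.utility_nonneg d, util d⟩)
  -- A courier `d` who accepts the undelivered order must get at least `k d` from it, as its own
  -- order still pays that much (or `d` is idle and `k d ≤ 0`). Quantifying over `a` instead of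
  -- taking the minimum over couriers includes the case of no couriers, where the minimum tip is
  -- infinite.
  have tip : ∀ b s, (∀ d, x b s d = false) → ∀ a : ℝ, (∀ d, a ≤ M.cost d b s + k d) →
      (a : EReal) ≤ M.minTip w 0 b s := by
    intro b s hbs a ha
    refine le_sInf ?_
    rintro _ ⟨τ, ⟨r, hr, rfl, d, hd⟩, rfl⟩
    refine EReal.coe_le_coe_iff.2 ((ha d).trans ?_)
    obtain ⟨h₀, h₁⟩ := some_mem_bestResponses.1 hd
    have e : M.courierUtility w (Function.update 0 b r) d (b, s) = - M.cost d b s + r s := by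
      simp [courierUtility, hw₀ b s hbs]
    rw [e] at h₀ h₁
    by_cases hd' : ∃ b' s', x b' s' d = true
    · obtain ⟨b', s', hx'⟩ := hd'
      have h₂ := h₁ (b', s')
      have h₃ : k d ≤ M.courierUtility w (Function.update 0 b r) d (b', s') := by
        rw [← util' d b' s' hx']
        simp only [courierUtility, Pi.zero_apply]
        gcongr
        by_cases hb : b' = b
        · subst hb; simpa using hr s'
        · simp [hb]
      linarith
    · have := h.idle d (by simpa using hd')
      linarith
  have buy : ∀ b (u : ℝ), (∀ s, (∀ d, x b s d = false) → ∀ d,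
      M.value b s - p s - u ≤ M.cost d b s + k d) →
      ∀ s, (∀ d, x b s d = false) → M.buyerUtility p w 0 b s ≤ u := by
    intro b u hu s hs
    have := EReal.sub_le_sub (le_refl ((M.value b s : EReal) - (p s : EReal)))
      (tip b s hs _ (hu s hs))
    refine this.trans ?_
    rw [← EReal.coe_sub, ← EReal.coe_sub, EReal.coe_le_coe_iff]
    linarith
  refine ⟨p, w, 0, h.price_nonneg, hwn, fun _ _ => le_rfl, hx, ?_, ?_, ?_,
    fun s hs => le_antisymm (h.unsold s hs) (h.price_nonneg s),
    fun b s hs => ⟨hw₀ b s hs, rfl⟩⟩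
  · rintro b (- | s) ho
    · refine none_mem_bestResponses.2 fun s => ?_
      have := buy b 0 (fun s _ d => by have := h.no_store b ho s d; linarith) s (ho s)
      simpa using this
    · obtain ⟨d, hd⟩ := ho
      have e : M.buyerUtility p w 0 b s = ((M.value b s - p s : ℝ) : EReal) := by
        rw [buyerUtility, tip₀ b s d hd, sub_zero, EReal.coe_sub]
      refine some_mem_bestResponses.2 ?_
      rw [e]
      refine ⟨EReal.coe_nonneg.2 (sub_nonneg.2 (h.price_le b s d hd)), fun s' => ?_⟩
      by_cases hs : s' = s
      · subst hs; exact e.le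
      · refine buy b _ (fun s' _ d' => ?_) s' fun d' => ?_
        · have := h.buyer b s d s' d' hd
          linarith
        · by_contra hd'
          exact hs (eq_and_eq_of_sum_le_one (hx.1 b) hd (by simpa using hd')).1.symm
  · rintro b s ⟨d, hd⟩
    rw [tip₀ b s d hd]
    rfl
  · rintro d (- | ⟨b, s⟩) ho
    · exact none_mem_bestResponses.2 fun q => (util d q).trans (h.idle d ho)
    · refine some_mem_bestResponses.2 ?_
      rw [util' d b s ho]
      exact ⟨h.utility_nonneg d, util d⟩

theorem supportsAllocation_iff : M.SupportsAllocation x ↔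
    x.IsFeasible ∧ ∃ k p, IsSolution M.value M.cost x k p :=
  ⟨fun ⟨p, _, _, h⟩ => ⟨h.feasible, let ⟨k, hk⟩ := h.exists_isSolution; ⟨k, p, hk⟩⟩,
    fun ⟨hx, _, _, h⟩ => isWithTipEquilibrium_of_isSolution hx h⟩

end Market

namespace IsSolution

variable {v : B → S → ℝ} {c : D → B → S → ℝ} {x : Allocation B S D} {k : D → ℝ} {p : S → ℝ}

/-- Solutions may be scaled. -/
theorem scale (h : IsSolution v c x k p) {a : ℝ} (ha : 0 ≤ a) :
    IsSolution (fun b s => a * v b s) (fun d b s => a * c d b s) x (fun d => a * k d)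
      fun s => a * p s where
  utility_nonneg d := mul_nonneg ha (h.utility_nonneg d)
  price_nonneg s := mul_nonneg ha (h.price_nonneg s)
  courier b s d d' hx := by nlinarith [h.courier b s d d' hx]
  buyer b s d s' d' hx := by nlinarith [h.buyer b s d s' d' hx]
  price_le b s d hx := by nlinarith [h.price_le b s d hx]
  no_store b hb s d := by nlinarith [h.no_store b hb s d]
  unsold s hs := by nlinarith [h.unsold s hs]
  idle d hd := by nlinarith [h.idle d hd]

/-- There is a bounded solution if there is any. -/
theorem exists_le [Fintype D] (h : IsSolution v c x k p) (hv : ∀ b s, 0 ≤ v b s)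
    (hc : ∀ d b s, 0 ≤ c d b s) {V C : ℝ} (hV : ∀ b s, v b s ≤ V) (hC : ∀ d b s, c d b s ≤ C)
    (hV₀ : 0 ≤ V) (hC₀ : 0 ≤ C) :
    ∃ k p, IsSolution v c x k p ∧ (∀ d, k d ≤ V + C) ∧ ∀ s, p s ≤ V + C := by
  have hp : ∀ s, p s ≤ V + C := by
    intro s
    by_cases hs : ∃ b d, x b s d = true
    · obtain ⟨b, d, hx⟩ := hs
      linarith [h.price_le b s d hx, hV b s]
    · linarith [h.unsold s (by simpa using hs)]
  -- The utility of an idle courier is zero, and any working courier exceeds it by at most a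
  -- difference of costs.
  by_cases hi : ∃ d₀, ∀ b s, x b s d₀ = false
  · obtain ⟨d₀, hd₀⟩ := hi
    refine ⟨k, p, h, fun d => ?_, hp⟩
    by_cases hd : ∃ b s, x b s d = true
    · obtain ⟨b, s, hx⟩ := hd
      linarith [h.courier b s d d₀ hx, h.idle d₀ hd₀, hC d₀ b s, hc d b s]
    · linarith [h.idle d (by simpa using hd)]
  · push Not at hi
    rcases isEmpty_or_nonempty D with hD | hD
    · exact ⟨k, p, h, fun d => hD.elim d, hp⟩
    · obtain ⟨d₁, hd₁⟩ := Finite.exists_max k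
      have hk : ∀ d, k d₁ - k d ≤ C := fun d => by
        obtain ⟨b, s, hx⟩ := hi d₁
        linarith [h.courier b s d₁ d (by simpa using hx), hC d b s, hc d₁ b s]
      -- If all couriers work, the utilities may be shifted by a common constant, since `courier`
      -- only sees differences. With the maximum moved to `V + C` all of them are at least `V`,
      -- which satisfies the buyers' inequalities even at zero prices.
      refine ⟨fun d => V + C - (k d₁ - k d), fun _ => 0, ⟨fun d => by linarith [hk d],
        fun _ => le_rfl, fun b s d d' hx => by linarith [h.courier b s d d' hx],
        fun b s d s' d' hx => by linarith [hk d', hV b s', hc d' b s', hv b s],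
        fun b s d hx => hv b s, fun b _ s d => by linarith [hk d, hV b s, hc d b s],
        fun _ _ => le_rfl, fun d hd => ?_⟩, fun d => by linarith [hd₁ d], fun _ => by linarith⟩
      obtain ⟨b, s, hx⟩ := hi d
      exact absurd (hd b s) hx

end IsSolution

end

end DeliveryMarket

namespace DeliveryMarket

/-! ### Correctness of the decision procedure -/

theorem forall_mem_cond {α : Type*} {b : Bool} {L : List α} {P : α → Prop} :
    (∀ q ∈ bif b then L else [], P q) ↔ (b = true → ∀ q ∈ L, P q) := by
  cases b <;> simp

section

variable {m n l : ℕ} {v : ℕ → ℕ → ℕ} {c : ℕ → ℕ → ℕ → ℕ} {x : ℕ → ℕ → ℕ → Bool}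

theorem forall_mem_constraints {P : Constraint → Prop} :
    (∀ q ∈ constraints m n l v c x, P q) ↔
      (∀ b < m, ∀ s < n, ∀ d < l, x b s d = true →
        (∀ d' < l, P (d, c b s d, d', l + n, c b s d')) ∧
        (∀ s' < n, ∀ d' < l, P (l + s, v b s', l + s', d', c b s' d' + v b s)) ∧
        P (l + s, 0, l + n, l + n, v b s)) ∧
      (∀ b < m, (∀ s < n, ∀ d < l, x b s d = false) → ∀ s < n, ∀ d < l,
        P (l + n, v b s, l + s, d, c b s d)) ∧
      (∀ s < n, (∀ b < m, ∀ d < l, x b s d = false) → P (l + s, 0, l + n, l + n, 0)) ∧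
      (∀ d < l, (∀ b < m, ∀ s < n, x b s d = false) → P (d, 0, l + n, l + n, 0)) := by
  simp only [constraints, orderConstraints, buyerConstraints, List.forall_mem_append,
    List.forall_mem_flatMap, List.forall_mem_map, forall_mem_cond, List.mem_range,
    List.forall_mem_singleton, List.all_eq_true, Bool.not_eq_true']

theorem getD_initial (M i : ℕ) : (initial n l M).getD i 0 = if i < l + n then M else 0 := by
  have e : initial n l M = List.replicate (l + n) M ++ [0] := by
    simp only [initial, List.map_const', List.length_range]
    rw [← List.append_assoc, List.replicate_append_replicate]
  rw [e]
  by_cases h : i < l + n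
  · rw [List.getD_append _ _ _ _ (by simpa using h), if_pos h]
    simp [h]
  · rw [List.getD_append_right _ _ _ _ (by simpa using h), if_neg h]
    cases i - (List.replicate (l + n) M).length <;> simp

theorem sum_map_range (n : ℕ) (f : ℕ → ℕ) : ((List.range n).map f).sum = ∑ i : Fin n, f i := by
  rw [← Finset.sum_range]
  rfl

theorem isFeasible_iff : isFeasible m n l x = true ↔
    Allocation.IsFeasible fun (b : Fin m) (s : Fin n) (d : Fin l) => x b s d := by
  have e : ∀ b : Bool, (bif b then 1 else 0) = b.toNat := fun b => by cases b <;> rfl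
  simp only [isFeasible, Allocation.IsFeasible, Bool.and_eq_true, List.all_eq_true, List.mem_range,
    Nat.ble_eq, sum_map_range, e, Fin.forall_iff]

theorem bound_eq : (bound m n l v c : ℝ) = (∑ b : Fin m, ∑ s : Fin n, (v b s : ℝ)) +
    ∑ b : Fin m, ∑ s : Fin n, ∑ d : Fin l, (c b s d : ℝ) := by
  simp only [bound, sum_map_range]
  push_cast
  rfl

theorem decideIntegral_iff : decideIntegral m n l v c x = true ↔
    (Allocation.IsFeasible fun (b : Fin m) (s : Fin n) (d : Fin l) => x b s d) ∧
    ∃ k p, IsSolution (fun (b : Fin m) (s : Fin n) => (v b s : ℝ))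
      (fun (d : Fin l) b s => (c b s d : ℝ)) (fun b s d => x b s d) k p := by
  rw [decideIntegral, Bool.and_eq_true, isFeasible_iff, check_solve_iff]
  swap
  · have hl : (initial n l (bound m n l v c)).length = l + n + 1 := by simp [initial]; omega
    rw [hl, forall_mem_constraints]
    refine ⟨fun b _ s hs d hd _ => ⟨fun _ _ => ?_, fun _ _ _ _ => ?_, ?_⟩, fun _ _ _ _ _ _ _ => ?_,
      fun _ _ _ => ?_, fun _ _ _ => ?_⟩ <;> dsimp only <;> omega
  refine and_congr_right fun _ => ?_
  simp only [forall_mem_constraints, getD_initial, Constraint.Holds]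
  constructor
  · rintro ⟨y, h₀, hM, h₁, h₂, h₃, h₄⟩
    -- The initial value of this variable is zero, so it acts as the constant zero.
    have hz : y (l + n) = 0 := le_antisymm (by simpa using hM (l + n)) (h₀ _)
    refine ⟨fun d => y d, fun s => y (l + s), fun d => h₀ d, fun s => h₀ _, fun b s d d' hx => ?_,
      fun b s d s' d' hx => ?_, fun b s d hx => ?_, fun b hb s d => ?_, fun s hs => ?_,
      fun d hd => ?_⟩
    · have := (h₁ b b.2 s s.2 d d.2 hx).1 d' d'.2
      linarith
    · have := (h₁ b b.2 s s.2 d d.2 hx).2.1 s' s'.2 d' d'.2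
      push_cast at this
      linarith
    · have := (h₁ b b.2 s s.2 d d.2 hx).2.2
      push_cast at this
      linarith
    · have := h₂ b b.2 (fun s hs d hd => hb ⟨s, hs⟩ ⟨d, hd⟩) s s.2 d d.2
      linarith
    · have := h₃ s s.2 (fun b hb d hd => hs ⟨b, hb⟩ ⟨d, hd⟩)
      push_cast at this
      linarith
    · have := h₄ d d.2 (fun b hb s hs => hd ⟨b, hb⟩ ⟨s, hs⟩)
      push_cast at this
      linarith
  · rintro ⟨k, p, h⟩
    have hv : ∀ (b : Fin m) (s : Fin n), (0 : ℝ) ≤ v b s := fun _ _ => Nat.cast_nonneg _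
    have hc : ∀ (d : Fin l) (b : Fin m) (s : Fin n), (0 : ℝ) ≤ c b s d :=
      fun _ _ _ => Nat.cast_nonneg _
    obtain ⟨k, p, h, hk, hp⟩ := h.exists_le hv hc
      (V := ∑ b : Fin m, ∑ s : Fin n, (v b s : ℝ))
      (C := ∑ b : Fin m, ∑ s : Fin n, ∑ d : Fin l, (c b s d : ℝ))
      (fun b s => (Finset.single_le_sum (f := fun s : Fin n => (v b s : ℝ))
          (fun s _ => hv b s) (Finset.mem_univ s)).trans
        (Finset.single_le_sum (f := fun b : Fin m => ∑ s : Fin n, (v b s : ℝ))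
          (fun b _ => Finset.sum_nonneg fun s _ => hv b s) (Finset.mem_univ b)))
      (fun d b s => (Finset.single_le_sum (f := fun d : Fin l => (c b s d : ℝ))
          (fun d _ => hc d b s) (Finset.mem_univ d)).trans
        ((Finset.single_le_sum (f := fun s : Fin n => ∑ d : Fin l, (c b s d : ℝ))
          (fun s _ => Finset.sum_nonneg fun d _ => hc d b s) (Finset.mem_univ s)).trans
        (Finset.single_le_sum (f := fun b : Fin m => ∑ s : Fin n, ∑ d : Fin l, (c b s d : ℝ))
          (fun b _ => Finset.sum_nonneg fun s _ => Finset.sum_nonneg fun d _ => hc d b s)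
          (Finset.mem_univ b))))
      (Finset.sum_nonneg fun b _ => Finset.sum_nonneg fun s _ => hv b s)
      (Finset.sum_nonneg fun b _ => Finset.sum_nonneg fun s _ => Finset.sum_nonneg fun d _ =>
        hc d b s)
    rw [← bound_eq] at hk hp
    let y : ℕ → ℝ := fun i =>
      if hi : i < l then k ⟨i, hi⟩ else if hi' : i - l < n ∧ i < l + n then p ⟨i - l, hi'.1⟩ else 0
    have yd : ∀ d (hd : d < l), y d = k ⟨d, hd⟩ := fun d hd => by simp [y, hd]
    have ys : ∀ s (hs : s < n), y (l + s) = p ⟨s, hs⟩ := fun s hs => by simp [y, hs]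
    have yz : y (l + n) = 0 := by simp [y]
    refine ⟨y, fun i => ?_, fun i => ?_, fun b hb s hs d hd hx => ⟨fun d' hd' => ?_,
      fun s' hs' d' hd' => ?_, ?_⟩, fun b hb hx s hs d hd => ?_, fun s hs hx => ?_,
      fun d hd hx => ?_⟩
    · simp only [y]
      split_ifs
      · exact h.utility_nonneg _
      · exact h.price_nonneg _
      · exact le_rfl
    · simp only [y]
      split_ifs with h₁ h₂ h₃ h₄ h₅
      · exact hk _
      · omega
      · exact hp _
      · omega
      · omega
      · simp
    · have := h.courier ⟨b, hb⟩ ⟨s, hs⟩ ⟨d, hd⟩ ⟨d', hd'⟩ hx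
      rw [yd d hd, yd d' hd', yz]
      linarith
    · have := h.buyer ⟨b, hb⟩ ⟨s, hs⟩ ⟨d, hd⟩ ⟨s', hs'⟩ ⟨d', hd'⟩ hx
      rw [ys s hs, ys s' hs', yd d' hd']
      push_cast
      exact this
    · have := h.price_le ⟨b, hb⟩ ⟨s, hs⟩ ⟨d, hd⟩ hx
      rw [ys s hs, yz]
      push_cast
      linarith
    · have := h.no_store ⟨b, hb⟩ (fun s d => hx s s.2 d d.2) ⟨s, hs⟩ ⟨d, hd⟩
      rw [yz, ys s hs, yd d hd]
      linarith
    · have := h.unsold ⟨s, hs⟩ fun b d => hx b b.2 d d.2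
      rw [yz, ys s hs]
      push_cast
      linarith
    · have := h.idle ⟨d, hd⟩ fun b s => hx b b.2 s s.2
      rw [yz, yd d hd]
      push_cast
      linarith

end

end DeliveryMarket

namespace DeliveryMarket

/-! ### Parsing the input -/

open StackProgram

/-- The fields of a word over the alphabet `Γ'`. -/
def parse (w : List Γ') : List (List Bool) := fields (w.map symbol).reverse

theorem parse_nil : parse [] = [[]] := rfl

/-- `fields` receives the reversed word, so the first symbol of the word is processed last: parsing
is a right fold, and the fields come out in their original order. -/
theorem parse_comma (w : List Γ') : parse (.comma :: w) = [] :: parse w := by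
  simp [parse, fields, symbol]

theorem parse_bit (b : Bool) {w : List Γ'} {u : List Bool} {r : List (List Bool)}
    (h : parse w = u :: r) : parse (.bit b :: w) = (b :: u) :: r := by
  simp_all [parse, fields, symbol]

theorem parse_bits (l : List Bool) {w : List Γ'} {u : List Bool} {r : List (List Bool)}
    (h : parse w = u :: r) : parse (l.map Γ'.bit ++ w) = (l ++ u) :: r := by
  induction l with
  | nil => exact h
  | cons b l ih => exact parse_bit b ih

theorem parse_field (l : List Bool) (w : List Γ') :
    parse (l.map Γ'.bit ++ .comma :: w) = l :: parse w := by
  simpa using parse_bits l (parse_comma w)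

theorem parse_encodeSize (k : ℕ) (w : List Γ') :
    parse (encodeSize k ++ w) = List.replicate k true :: parse w := by
  simpa [encodeSize] using parse_field (List.replicate k true) w

theorem parse_encodeRat (q : ℚ≥0) (w : List Γ') :
    parse (encodeRat q ++ w) = encodeNat q.num :: encodeNat q.den :: parse w := by
  have e : encodeRat q ++ w = (encodeNat q.num).map Γ'.bit ++ .comma ::
      ((encodeNat q.den).map Γ'.bit ++ .comma :: w) := by
    simp [encodeRat, encodingNatΓ', inclusionBoolΓ']
  rw [e, parse_field, parse_field]

theorem parse_flatMap_encodeRat (L : List ℚ≥0) (w : List Γ') :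
    parse (L.flatMap encodeRat ++ w) =
      (L.flatMap fun q => [encodeNat q.num, encodeNat q.den]) ++ parse w := by
  induction L with
  | nil => rfl
  | cons q L ih => simp [List.flatMap_cons, parse_encodeRat, ih]

theorem ofDigits_encodeNat (n : ℕ) : ofDigits (encodeNat n) = n := by
  have h : ∀ p : PosNum, ofDigits (encodePosNum p) = (p : ℕ) := by
    intro p
    induction p with
    | one => simp [encodePosNum]
    | bit1 p ih => rw [encodePosNum, ofDigits_cons, ih, PosNum.cast_bit1, two_mul]; rfl
    | bit0 p ih => rw [encodePosNum, ofDigits_cons, ih, PosNum.cast_bit0, two_mul]; rfl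
  have h' : ∀ p : Num, ofDigits (encodeNum p) = (p : ℕ)
    | .zero => rfl
    | .pos p => h p
  rw [encodeNat, h', Num.to_of_nat]

theorem length_flatMap {α β : Type*} {L : List α} {f : α → List β} {k : ℕ}
    (hf : ∀ a, (f a).length = k) : (L.flatMap f).length = L.length * k := by
  simp [List.length_flatMap, hf]

/-- Row-major indexing: the blocks before block `i` occupy `i * k` places. It locates the entries of
the encoded tables. -/
theorem getElem?_flatMap {α β : Type*} {L : List α} {f : α → List β} {k i j : ℕ} {a : α}
    (hf : ∀ a, (f a).length = k) (hi : L[i]? = some a) (hj : j < k) :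
    (L.flatMap f)[i * k + j]? = (f a)[j]? := by
  induction L generalizing i with
  | nil => simp at hi
  | cons a' L ih =>
    rw [List.flatMap_cons]
    cases i with
    | zero =>
      obtain rfl : a' = a := by simpa using hi
      rw [zero_mul, zero_add, List.getElem?_append_left (by rw [hf]; exact hj)]
    | succ i =>
      rw [List.getElem?_append_right (by rw [hf, Nat.succ_mul]; omega),
        ← ih (i := i) (by simpa using hi)]
      congr 1
      rw [hf, Nat.succ_mul]
      omega

theorem getElem?_finRange {n : ℕ} (i : Fin n) : (List.finRange n)[(i : ℕ)]? = some i := by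
  simp

/-- The rational numbers of an input, in the order of the encoding. -/
def Input.rationals (I : Input) : List ℚ≥0 :=
  ((List.finRange I.m).flatMap fun b => (List.finRange I.n).map fun s => I.value b s) ++
  ((List.finRange I.m).flatMap fun b => (List.finRange I.n).flatMap fun s =>
    (List.finRange I.l).map fun d => I.cost d b s)

/-- The table of the allocation of an input, in the order of the encoding. -/
def Input.table (I : Input) : List Bool :=
  (List.finRange I.m).flatMap fun b => (List.finRange I.n).flatMap fun s =>
    (List.finRange I.l).map fun d => I.alloc b s d

variable (I : Input)

theorem Input.rationals_value (b : Fin I.m) (s : Fin I.n) :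
    I.rationals[b * I.n + s]? = some (I.value b s) := by
  have h := getElem?_flatMap (f := fun b => (List.finRange I.n).map fun s => I.value b s)
    (k := I.n) (by simp) (getElem?_finRange b) s.2
  rw [List.getElem?_map, getElem?_finRange] at h
  rw [Input.rationals, List.getElem?_append_left, h]
  · rfl
  · exact (List.getElem?_eq_some_iff.1 h).1

theorem getElem?_finRange_flatMap {α : Type*} {m n l : ℕ} (f : Fin m → Fin n → Fin l → α)
    (b : Fin m) (s : Fin n) (d : Fin l) :
    ((List.finRange m).flatMap fun b => (List.finRange n).flatMap fun s =>
      (List.finRange l).map fun d => f b s d)[(b * n + s) * l + d]? = some (f b s d) := by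
  have h := getElem?_flatMap (f := fun b => (List.finRange n).flatMap fun s =>
      (List.finRange l).map fun d => f b s d) (k := n * l) (j := s * l + d)
    (fun b => by rw [length_flatMap (k := l) (by simp), List.length_finRange])
    (getElem?_finRange b) (by nlinarith [s.2, d.2])
  rw [getElem?_flatMap (k := l) (by simp) (getElem?_finRange s) d.2, List.getElem?_map,
    getElem?_finRange] at h
  rw [add_mul, mul_assoc, add_assoc, h]
  rfl

theorem Input.rationals_cost (b : Fin I.m) (s : Fin I.n) (d : Fin I.l) :
    I.rationals[I.m * I.n + ((b * I.n + s) * I.l + d)]? = some (I.cost d b s) := by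
  have h : ((List.finRange I.m).flatMap fun b =>
      (List.finRange I.n).map fun s => I.value b s).length = I.m * I.n := by
    rw [length_flatMap (k := I.n) (by simp), List.length_finRange]
  rw [Input.rationals, List.getElem?_append_right (by omega), h, Nat.add_sub_cancel_left]
  exact getElem?_finRange_flatMap (fun b s d => I.cost d b s) b s d

theorem Input.parse_encode : parse I.encode =
    [List.replicate I.m true, List.replicate I.n true, List.replicate I.l true] ++
      ((I.rationals.flatMap fun q => [encodeNat q.num, encodeNat q.den]) ++ [I.table]) := by
  have e : I.encode = encodeSize I.m ++ (encodeSize I.n ++ (encodeSize I.l ++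
      (I.rationals.flatMap encodeRat ++ (I.table.map Γ'.bit ++ [])))) := by
    simp [Input.encode, Input.rationals, Input.table, List.flatMap_map, List.map_flatMap,
      List.flatMap_assoc, List.append_assoc, Function.comp_def]
  rw [e, parse_encodeSize, parse_encodeSize, parse_encodeSize, parse_flatMap_encodeRat,
    parse_bits _ parse_nil]
  simp

theorem numBuyers_parse : numBuyers (parse I.encode) = I.m := by
  simp [numBuyers, I.parse_encode]

theorem numStores_parse : numStores (parse I.encode) = I.n := by
  simp [numStores, I.parse_encode]

theorem numCouriers_parse : numCouriers (parse I.encode) = I.l := by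
  simp [numCouriers, I.parse_encode]

theorem length_parse : (parse I.encode).length = 2 * I.rationals.length + 4 := by
  rw [I.parse_encode, List.length_append, List.length_append, length_flatMap (k := 2) (by simp)]
  simp
  omega

theorem allocated_parse (b : Fin I.m) (s : Fin I.n) (d : Fin I.l) :
    allocated (parse I.encode) b s d = I.alloc b s d := by
  have h : (parse I.encode).getD ((parse I.encode).length - 1) [] = I.table := by
    rw [length_parse, I.parse_encode, List.getD_append_right _ _ _ _ (by simp),
      List.getD_append_right _ _ _ _ (by rw [length_flatMap (k := 2) (by simp)]; simp; omega),
      length_flatMap (k := 2) (by simp)]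
    rw [show 2 * I.rationals.length + 4 - 1 - [List.replicate I.m true, List.replicate I.n true,
      List.replicate I.l true].length - I.rationals.length * 2 = 0 by simp; omega]
    rfl
  rw [allocated, h, numStores_parse, numCouriers_parse, List.getD_eq_getElem?_getD, Input.table,
    getElem?_finRange_flatMap I.alloc]
  rfl

theorem getElem?_parse {i j : ℕ} {q : ℚ≥0} (hi : I.rationals[i]? = some q) (hj : j < 2) :
    (parse I.encode)[3 + (2 * i + j)]? = [encodeNat q.num, encodeNat q.den][j]? := by
  have h := getElem?_flatMap (f := fun q : ℚ≥0 => [encodeNat q.num, encodeNat q.den]) (k := 2)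
    (by simp) hi hj
  rw [I.parse_encode, List.getElem?_append_right (by simp), List.length_cons, List.length_cons,
    List.length_cons, List.length_nil, Nat.add_sub_cancel_left, List.getElem?_append_left,
    mul_comm, h]
  rw [List.getElem?_eq_getElem (l := [_, _]) hj] at h
  rw [mul_comm]
  exact (List.getElem?_eq_some_iff.1 h).1

theorem numerator_parse {i : ℕ} {q : ℚ≥0} (hi : I.rationals[i]? = some q) :
    numerator (parse I.encode) i = q.num := by
  rw [numerator, List.getD_eq_getElem?_getD, ← Nat.add_zero (2 * i),
    getElem?_parse I hi (by norm_num)]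
  exact ofDigits_encodeNat _

theorem denominator_parse {i : ℕ} {q : ℚ≥0} (hi : I.rationals[i]? = some q) :
    denominator (parse I.encode) i = q.den := by
  rw [denominator, List.getD_eq_getElem?_getD, show 4 + 2 * i = 3 + (2 * i + 1) by omega,
    getElem?_parse I hi (by norm_num)]
  exact ofDigits_encodeNat _

/-- Beyond the last rational number the default digits `[true]` give one, so such indices do not
affect the product of the denominators. -/
theorem denominator_parse_pos (i : ℕ) : 0 < denominator (parse I.encode) i := by
  by_cases h : i < I.rationals.length
  · rw [denominator_parse I (List.getElem?_eq_getElem h)]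
    exact NNRat.den_pos _
  · rw [denominator, List.getD_eq_default _ _ (by rw [length_parse]; omega)]
    simp [ofDigits_cons]

/-- The product of all denominators. -/
def commonDenominator (E : List (List Bool)) : ℕ :=
  ((List.range E.length).map (denominator E)).prod

/-- Multiplying by the denominator puts back the factor that `scaled` leaves out. -/
theorem scaled_mul_denominator (E : List (List Bool)) {i : ℕ} (hi : i < E.length) :
    scaled E i * denominator E i = numerator E i * commonDenominator E := by
  have h : ((List.range E.length).map fun j =>
      bif Nat.beq j i then 1 else denominator E j).prod * denominator E i =
      commonDenominator E := by
    change (∏ j ∈ Finset.range E.length, bif Nat.beq j i then 1 else denominator E j) * _ =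
      ∏ j ∈ Finset.range E.length, denominator E j
    have e : (∏ j ∈ Finset.range E.length, if j = i then denominator E j else 1) =
        denominator E i := by
      rw [Finset.prod_ite_eq', if_pos (Finset.mem_range.2 hi)]
    rw [← e, ← Finset.prod_mul_distrib]
    refine Finset.prod_congr rfl fun j _ => ?_
    by_cases hj : j = i
    · simp [hj]
    · have : Nat.beq j i = false := Bool.eq_false_iff.2 fun h => hj (Nat.eq_of_beq_eq_true h)
      simp [hj, this]
  rw [scaled, mul_assoc, h]

theorem scaled_parse {i : ℕ} {q : ℚ≥0} (hi : I.rationals[i]? = some q) :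
    (scaled (parse I.encode) i : ℝ) = commonDenominator (parse I.encode) * (q : ℝ) := by
  have h := scaled_mul_denominator (parse I.encode) (i := i) (by
    have := (List.getElem?_eq_some_iff.1 hi).1
    rw [length_parse]
    omega)
  rw [denominator_parse I hi, numerator_parse I hi] at h
  have hq : (q.den : ℝ) ≠ 0 := Nat.cast_ne_zero.2 q.den_ne_zero
  rw [NNRat.cast_def, ← mul_div_assoc, eq_div_iff hq, mul_comm (commonDenominator _ : ℝ)]
  exact_mod_cast h

theorem decideFields_parse :
    decideFields (parse I.encode) = true ↔ I.market.SupportsAllocation I.alloc := by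
  have hQ : (0 : ℝ) < commonDenominator (parse I.encode) :=
    Nat.cast_pos.2 (List.prod_pos (by simp [denominator_parse_pos]))
  set Q : ℝ := (commonDenominator (parse I.encode) : ℝ)
  have hv : (fun (b : Fin I.m) (s : Fin I.n) => (scaledValue (parse I.encode) b s : ℝ)) =
      fun b s => Q * I.market.value b s := by
    funext b s
    rw [scaledValue, numStores_parse]
    exact scaled_parse I (I.rationals_value b s)
  have hc : (fun (d : Fin I.l) (b : Fin I.m) (s : Fin I.n) =>
      (scaledCost (parse I.encode) b s d : ℝ)) = fun d b s => Q * I.market.cost d b s := by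
    funext d b s
    rw [scaledCost, numBuyers_parse, numStores_parse, numCouriers_parse]
    exact scaled_parse I (I.rationals_cost b s d)
  have hx : (fun (b : Fin I.m) (s : Fin I.n) (d : Fin I.l) =>
      allocated (parse I.encode) b s d) = I.alloc := by
    funext b s d
    exact allocated_parse I b s d
  rw [decideFields, numBuyers_parse, numStores_parse, numCouriers_parse, decideIntegral_iff, hv,
    hc, hx, Market.supportsAllocation_iff]
  -- The integral data are the original ones times `Q > 0`, so solutions correspond under scaling by
  -- `Q` and its inverse.
  refine and_congr_right fun _ => ⟨fun ⟨k, p, h⟩ => ?_, fun ⟨k, p, h⟩ => ⟨_, _, h.scale hQ.le⟩⟩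
  have := h.scale (inv_nonneg.2 hQ.le)
  simp only [inv_mul_cancel_left₀ hQ.ne'] at this
  exact ⟨_, _, this⟩

end DeliveryMarket

/-- Given a market and an allocation, it can be decided in polynomial time whether some with-tip
equilibrium of the market includes the allocation. -/
theorem mainTheorem9 :
    DeliveryMarket.DecidableInPolyTime DeliveryMarket.Input.encode
      (fun I : DeliveryMarket.Input => I.market.SupportsAllocation I.alloc) :=
  StackProgram.PolyTime.decidableInPolyTime
    (StackProgram.PolyTime.decideFields.comp StackProgram.PolyTime.fields) _ _
    DeliveryMarket.decideFields_parse
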